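/- Let $A,A'$ be finite alphabets and let $X\subseteq A^{\mathbb Z}$, $X'\subseteq A'^{\mathbb Z}$ be sofic shifts, that is, sets of all biinfinite words having no factor in some given regular language. Let $\mathcal A,\mathcal A'$ be the Krieger automata of $X,X'$. Then the following conditions are equivalent: (i) $X$ and $X'$ are conjugate; (ii) the adjacency matrices of $\mathcal A$ and $\mathcal A'$ are symbolic strong shift equivalent; (iii) $\mathcal A$ and $\mathcal A'$ are symbolic conjugate. If moreover $X$ and $X'$ are irreducible (for all blocks $u,v$ of the shift there is a block $w$ such that $uwv$ is a block), then the same three conditions are also equivalent when $\mathcal A,\mathcal A'$ denote instead the Fischer automata of $X,X'$. Here the notions are the following. *Conjugacy.* A conjugacy between shift spaces is a continuous bijection commuting with the shift, where the alphabets are discrete and the spaces of biinfinite words carry the product topology. *Krieger and Fischer automata.* For a left infinite word $y=\cdots y_{-1}y_0$ over $A$, let $C_X(y)=\{z\in A^{\mathbb N} : y\cdot z\in X\}$. The Krieger automaton of $X$ has as states the nonempty sets of the form $C_X(y)$ and as edges the triples $(C_X(y),a,C_X(ya))$ with $a\in A$ for which $C_X(y)$ and $C_X(ya)$ are both nonempty;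 the edge $(p,a,q)$ goes from $p$ to $q$ and has label $a$. The Fischer automaton of an irreducible sofic shift $X$ is the restriction of the Krieger automaton to its unique strongly connected component that is closed under successors (it is the empty automaton if $X=\emptyset$). *Symbolic conjugacy.* For an automaton $\mathcal A$, let $X_{\mathcal A}$ be the shift of its biinfinite paths (sequences of edges), $\lambda_{\mathcal A}$ the map sending a path to its sequence of labels, and $L_{\mathcal A}=\lambda_{\mathcal A}(X_{\mathcal A})$. Automata $\mathcal A,\mathcal B$ are symbolic conjugate if there are conjugacies $\varphi:X_{\mathcal A}\to X_{\mathcal B}$ and $\psi:L_{\mathcal A}\to L_{\mathcal B}$ with $\psi\circ\lambda_{\mathcal A}=\lambda_{\mathcal B}\circ\varphi$. *Symbolic strong shift equivalence.* The adjacency matrix of $\mathcal A$ is the matrix indexed by the states whose $(p,q)$ entry is $\sum_a n_a\,a$, where $n_a$ is the number of edges from $p$ to $q$ labeled $a$. A matrix is alphabetic over a finite alphabet if its entries are linear forms in the (noncommuting) letters with coefficients in $\mathbb N$. Write $M\leftrightarrow N$ if the two matrices are equal up to a bijection between the letters occurring in $M$ and those occurring in $N$. Finite square alphabetic matrices $M,M'$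 are symbolic elementary equivalent if there are alphabetic matrices $R,S$, over finite alphabets $C,D$, such that $M\leftrightarrow RS$ and $M'\leftrightarrow SR$, where the two-letter words in $CD$ and in $DC$ that occur in the products are regarded as letters. Symbolic strong shift equivalence means the existence of a finite chain $M=M_0,M_1,\dots,M_n=M'$ in which consecutive matrices are symbolic elementary equivalent. -/

import Mathlib

universe u

namespace SoficShift

/-! ### Shift spaces, sofic shifts, irreducibility, conjugacy -/

/-- The finite word `w` is a factor of the biinfinite word `x`. -/
def IsFactor {A : Type u} (w : List A) (x : ℤ → A) : Prop :=
  ∃ i : ℤ, ∀ (k : ℕ) (hk : k < w.length), x (i + k) = w[k]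

/-- The shift space of all biinfinite words none of whose factors is in `W`. -/
def avoiding {A : Type u} (W : Language A) : Set (ℤ → A) :=
  {x | ∀ w ∈ W, ¬ IsFactor w x}

/-- A sofic shift: the set of biinfinite words that avoid some recognizable (regular) set of
words. Such a set is automatically closed and shift-invariant. -/
def IsSofic {A : Type u} (X : Set (ℤ → A)) : Prop :=
  ∃ W : Language A, W.IsRegular ∧ X = avoiding W

/-- The blocks of `X`: the factors of its elements. -/
def blocks {A : Type u} (X : Set (ℤ → A)) : Set (List A) :=
  {w | ∃ x ∈ X, IsFactor w x}

/-- Irreducibility of a shift space. -/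
def IsIrreducible {A : Type u} (X : Set (ℤ → A)) : Prop :=
  ∀ u ∈ blocks X, ∀ v ∈ blocks X, ∃ w ∈ blocks X, u ++ w ++ v ∈ blocks X

/-- `φ` is a conjugacy from the shift space `X` onto the shift space `Y`: a continuous bijection
(for the product topologies of the discrete topologies on the alphabets) that commutes with the
shift. -/
def IsConjugacy {A B : Type u} (X : Set (ℤ → A)) (Y : Set (ℤ → B)) (φ : X → Y) : Prop :=
  letI : TopologicalSpace A := ⊥
  letI : TopologicalSpace B := ⊥
  Continuous φ ∧ Function.Bijective φ ∧
    ∀ x x' : X, (x' : ℤ → A) = SymbolicDynamics.FullShift.shift (1 : ℤ) (x : ℤ → A) →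
      (φ x' : ℤ → B) = SymbolicDynamics.FullShift.shift (1 : ℤ) (φ x : ℤ → B)

/-- Two shift spaces are conjugate. -/
def AreConjugate {A B : Type u} (X : Set (ℤ → A)) (Y : Set (ℤ → B)) : Prop :=
  ∃ φ : X → Y, IsConjugacy X Y φ

/-! ### Automata -/

/-- An automaton on the alphabet `A`, all of whose states are initial and final: a directed
graph with edges labeled by letters. -/
structure Automaton (A : Type u) where
  /-- the states -/
  State : Type u
  /-- the edges -/
  Edge : Type u
  /-- the initial state of an edge -/
  source : Edge → State
  /-- the terminal state of an edge -/
  target : Edge → State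
  /-- the label of an edge -/
  label : Edge → A

namespace Automaton

variable {A : Type u}

/-- The edge shift of an automaton: its biinfinite paths. -/
def edgeShift (𝒜 : Automaton A) : Set (ℤ → 𝒜.Edge) :=
  {x | ∀ n : ℤ, 𝒜.target (x n) = 𝒜.source (x (n + 1))}

/-- The shift recognized by an automaton: the labels of its biinfinite paths. -/
def labelShift (𝒜 : Automaton A) : Set (ℤ → A) :=
  {y | ∃ x ∈ 𝒜.edgeShift, y = fun n => 𝒜.label (x n)}

/-- The map from the edge shift to the recognized shift that sends a path to its label. -/
def labelMap (𝒜 : Automaton A) (x : 𝒜.edgeShift) : 𝒜.labelShift :=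
  ⟨fun n => 𝒜.label (x.1 n), x.1, x.2, rfl⟩

/-- There is a (possibly empty) finite path from `p` to `q`. -/
def Reachable (𝒜 : Automaton A) : 𝒜.State → 𝒜.State → Prop :=
  Relation.ReflTransGen fun p q => ∃ e : 𝒜.Edge, 𝒜.source e = p ∧ 𝒜.target e = q

/-- A strongly connected component (class of mutually reachable states). -/
def IsComponent (𝒜 : Automaton A) (S : Set 𝒜.State) : Prop :=
  ∃ p, S = {q | 𝒜.Reachable p q ∧ 𝒜.Reachable q p}

/-- A strongly connected component that contains all successors of its states. -/
def IsMinimalComponent (𝒜 : Automaton A) (S : Set 𝒜.State) : Prop :=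
  𝒜.IsComponent S ∧ ∀ e : 𝒜.Edge, 𝒜.source e ∈ S → 𝒜.target e ∈ S

/-- The restriction of an automaton to a set of states. -/
def restrict (𝒜 : Automaton A) (S : Set 𝒜.State) : Automaton A where
  State := S
  Edge := {e : 𝒜.Edge // 𝒜.source e ∈ S ∧ 𝒜.target e ∈ S}
  source e := ⟨𝒜.source e.1, e.2.1⟩
  target e := ⟨𝒜.target e.1, e.2.2⟩
  label e := 𝒜.label e.1

end Automaton

/-- Symbolic conjugacy of automata: conjugacies between the edge shifts and between the recognized
shifts that are compatible with the labelings. -/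
def SymbolicConjugate {A B : Type u} (𝒜 : Automaton A) (ℬ : Automaton B) : Prop :=
  ∃ (φ : 𝒜.edgeShift → ℬ.edgeShift) (ψ : 𝒜.labelShift → ℬ.labelShift),
    IsConjugacy 𝒜.edgeShift ℬ.edgeShift φ ∧ IsConjugacy 𝒜.labelShift ℬ.labelShift ψ ∧
      ∀ x, ψ (𝒜.labelMap x) = ℬ.labelMap (φ x)

/-! ### Krieger and Fischer automata

A left infinite word `⋯ y₋₂ y₋₁ y₀` is represented by the function `n ↦ y₋ₙ` on `ℕ`. -/

/-- The biinfinite word `y · z`, with `z` placed on the nonnegative positions. -/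
def join {A : Type u} (y z : ℕ → A) : ℤ → A
  | Int.ofNat n => z n
  | Int.negSucc n => y n

/-- The left infinite word `y a`. -/
def append {A : Type u} (y : ℕ → A) (a : A) : ℕ → A
  | 0 => a
  | n + 1 => y n

/-- The set of right contexts of the left infinite word `y`. -/
def rightContexts {A : Type u} (X : Set (ℤ → A)) (y : ℕ → A) : Set (ℕ → A) :=
  {z | join y z ∈ X}

/-- The Krieger automaton of `X`: its states are the nonempty sets of right contexts of left
infinite words, and its edges are the triples `(C(y), a, C(ya))` of a state, a letter and a
state. -/
def krieger {A : Type u} (X : Set (ℤ → A)) : Automaton A where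
  State := {p : Set (ℕ → A) // p.Nonempty ∧ ∃ y, p = rightContexts X y}
  Edge := {e : {p : Set (ℕ → A) // p.Nonempty ∧ ∃ y, p = rightContexts X y} × A ×
      {p : Set (ℕ → A) // p.Nonempty ∧ ∃ y, p = rightContexts X y} //
    ∃ y, e.1.1 = rightContexts X y ∧ e.2.2.1 = rightContexts X (append y e.2.1)}
  source e := e.1.1
  target e := e.1.2.2
  label e := e.1.2.1

/-- The Fischer automaton of `X`: the restriction of the Krieger automaton to its minimal strongly
connected component. (The set of states below is the union of all minimal components; an
irreducible sofic shift that is not empty has exactly one.) -/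
def fischer {A : Type u} (X : Set (ℤ → A)) : Automaton A :=
  (krieger X).restrict {p | ∃ S, (krieger X).IsMinimalComponent S ∧ p ∈ S}

/-! ### Alphabetic matrices and symbolic strong shift equivalence

A homogeneous polynomial of degree one over the alphabet `A` with coefficients in `ℕ` is
represented by the function `A → ℕ` giving the coefficients of the letters. -/

/-- The letters that occur in an alphabetic matrix. -/
def letters {P Q A : Type u} (M : Matrix P Q (A → ℕ)) : Set A :=
  {a | ∃ p q, M p q a ≠ 0}

/-- The product of two alphabetic matrices, over the alphabet of two-letter words `cd`:
the coefficient of `cd` in the `(p, r)` entry is `∑ q, (R p q, c) (S q r, d)`. -/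
def product {P Q T C D : Type u} [Fintype Q]
    (R : Matrix P Q (C → ℕ)) (S : Matrix Q T (D → ℕ)) : Matrix P T (C × D → ℕ) :=
  Matrix.of fun p r cd => ∑ q, R p q cd.1 * S q r cd.2

/-- Similarity: equality up to a bijection between the letters that occur in the two matrices. -/
def SimilarMatrices {P Q A B : Type u} (M : Matrix P Q (A → ℕ)) (N : Matrix P Q (B → ℕ)) : Prop :=
  ∃ f : letters M ≃ letters N, ∀ p q (a : letters M), M p q a = N p q (f a)

/-- A square alphabetic matrix with its index set and its alphabet. -/
structure SquareMatrix where
  /-- the index set -/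
  Index : Type u
  /-- the alphabet -/
  Letter : Type u
  /-- the entries -/
  entries : Matrix Index Index (Letter → ℕ)

/-- Symbolic elementary equivalence of finite square alphabetic matrices over finite alphabets. -/
def SymbolicElementaryEquivalent (M N : SquareMatrix.{u}) : Prop :=
  ∃ (_ : Fintype M.Index) (_ : Fintype N.Index) (_ : Finite M.Letter) (_ : Finite N.Letter)
    (C D : Type u) (_ : Finite C) (_ : Finite D)
    (R : Matrix M.Index N.Index (C → ℕ)) (S : Matrix N.Index M.Index (D → ℕ)),
    SimilarMatrices M.entries (product R S) ∧ SimilarMatrices N.entries (product S R)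

/-- Symbolic strong shift equivalence: existence of a finite chain of symbolic elementary
equivalences. -/
def SymbolicStrongShiftEquivalent : SquareMatrix.{u} → SquareMatrix.{u} → Prop :=
  Relation.ReflTransGen SymbolicElementaryEquivalent

/-- The adjacency matrix of an automaton: the coefficient of `a` in the `(p, q)` entry is the number
of edges from `p` to `q` labeled `a`. -/
noncomputable def Automaton.adjacencyMatrix {A : Type u} (𝒜 : Automaton A) : SquareMatrix.{u} where
  Index := 𝒜.State
  Letter := A
  entries := Matrix.of fun p q a =>
    Nat.card {e : 𝒜.Edge // 𝒜.source e = p ∧ 𝒜.target e = q ∧ 𝒜.label e = a}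

end SoficShift

/-!
The two parts of the theorem are proved along the cycle "conjugate, hence symbolic strong shift
equivalent matrices, hence symbolic conjugate automata, hence conjugate".

*From a conjugacy to matrices.* An invertible system `T` on `Ω` with a map `α` from `Ω` to a finite
alphabet, a coding, gives a shift space: the set of itineraries `n ↦ α (Tⁿ ω)`. The elementary move
is the bipartite one: the letter of `α` is a word `c d` of half-letters, and the letter of `α'` is
`d (c ∘ T)`. The past of a point for `α'` is its past for `α` with the half-letter `c` appended, so
appending `c`, and then `d`, defines deterministic half-steps between the Krieger states of the two
shifts. Consecutive half-steps compose to the edges of the two Krieger automata, hence the adjacency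
matrices are `R S` and `S R` up to similarity (`Bipartite.elementaryEquivalent`). Half-steps
preserve the property of lying in a minimal component, so the same factorization works for the
Fischer automata, and by determinism they preserve the finiteness of the Krieger automaton.
A conjugacy of `X` onto `X'` gives two codings of the system `X`, the letter at `0` of a point and
the letter at `0` of its image. By compactness each is determined by a finite window of
the other, and enlarging a window by one position is a bipartite move (`linked_of_windows`).
Sofic shifts have finite Krieger automata since a nonempty set of right contexts is determined by
the set of states that the suffixes of the past reach in a finite automaton recognizing the
forbidden words (`IsSofic.finite_krieger`).

*From matrices to automata.* If the matrices are `R S` and `S R` up to similarity, then edges are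
pairs of half-edges, and moving the brackets in a biinfinite path by one half-edge is a conjugacy of
the edge shifts that induces a conjugacy of the label shifts (`symbolicConjugate_of_halfEdges`).

*From automata to shifts.* The Krieger automaton recognizes `X`. So does the Fischer automaton if
`X` is irreducible: a state of the Fischer automaton, as a set of right contexts, only depends
on a long enough finite suffix of the past (`exists_suffix_determining_context`), so by
irreducibility any block can be read in the Fischer automaton, and compactness extends this from
blocks to biinfinite words.
-/

namespace SoficShift

/-! ### Conjugacies and window maps -/

/-- A map between shift spaces is continuous if each coordinate of the image depends on finitely
many coordinates of the argument. -/
theorem continuous_of_finite_window {A B : Type u} [TopologicalSpace A] [DiscreteTopology A]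
    [TopologicalSpace B] [DiscreteTopology B] {X : Set (ℤ → A)} {Y : Set (ℤ → B)} (φ : X → Y)
    (h : ∀ n : ℤ, ∃ F : Finset ℤ, ∀ x x' : X, (∀ i ∈ F, x.1 i = x'.1 i) →
      (φ x).1 n = (φ x').1 n) : Continuous φ := by
  refine Continuous.subtype_mk (f := fun x => (φ x).1) (continuous_pi fun n => ?_) _
  obtain ⟨F, hF⟩ := h n
  refine IsLocallyConstant.continuous ((IsLocallyConstant.iff_exists_open _).2 fun x => ?_)
  refine ⟨Subtype.val ⁻¹' SymbolicDynamics.FullShift.cylinder F x.1,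
    (SymbolicDynamics.FullShift.isOpen_cylinder F x.1).preimage continuous_subtype_val,
    fun i _ => rfl, fun x' hx' => hF _ _ hx'⟩

theorem IsConjugacy.comp {A B C : Type u} {X : Set (ℤ → A)} {Y : Set (ℤ → B)} {Z : Set (ℤ → C)}
    {φ : X → Y} {ψ : Y → Z} (hψ : IsConjugacy Y Z ψ) (hφ : IsConjugacy X Y φ) :
    IsConjugacy X Z (ψ ∘ φ) := by
  let _ : TopologicalSpace A := ⊥
  let _ : TopologicalSpace B := ⊥
  let _ : TopologicalSpace C := ⊥
  exact ⟨hψ.1.comp hφ.1, hψ.2.1.comp hφ.2.1, fun x x' h => hψ.2.2 _ _ (hφ.2.2 _ _ h)⟩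

theorem SymbolicConjugate.trans {A B C : Type u} {𝒜 : Automaton A} {ℬ : Automaton B}
    {𝒞 : Automaton C} (h : SymbolicConjugate 𝒜 ℬ) (h' : SymbolicConjugate ℬ 𝒞) :
    SymbolicConjugate 𝒜 𝒞 := by
  obtain ⟨φ, ψ, hφ, hψ, hc⟩ := h
  obtain ⟨φ', ψ', hφ', hψ', hc'⟩ := h'
  exact ⟨φ' ∘ φ, ψ' ∘ ψ, hφ'.comp hφ, hψ'.comp hψ, fun x => by simp [hc, hc']⟩

/-! ### From symbolic strong shift equivalence to symbolic conjugacy -/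

/-- Suppose that the edges of `𝒜` are words `ρ σ` and those of `ℬ` are words `σ ρ` of half-edges,
that two edges are consecutive exactly when their inner halves form an edge of the
other automaton, and that labels are likewise made of labels of half-edges. Then moving the brackets
by one half-edge is a symbolic conjugacy. -/
theorem symbolicConjugate_of_halfEdges {A B : Type u} {C D ER ES : Type*}
    {𝒜 : Automaton A} {ℬ : Automaton B}
    (ρ : 𝒜.Edge → ER) (σ : 𝒜.Edge → ES) (σ' : ℬ.Edge → ES) (ρ' : ℬ.Edge → ER)
    (lR : ER → C) (lS : ES → D)
    (inj : ∀ e e', ρ e = ρ e' → σ e = σ e' → e = e')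
    (inj' : ∀ e e', σ' e = σ' e' → ρ' e = ρ' e' → e = e')
    (adj : ∀ e e', 𝒜.target e = 𝒜.source e' ↔ ∃ b, σ' b = σ e ∧ ρ' b = ρ e')
    (adj' : ∀ b b', ℬ.target b = ℬ.source b' ↔ ∃ e, ρ e = ρ' b ∧ σ e = σ' b')
    (lab : ∀ e e', 𝒜.label e = 𝒜.label e' ↔ lR (ρ e) = lR (ρ e') ∧ lS (σ e) = lS (σ e'))
    (lab' : ∀ b b', ℬ.label b = ℬ.label b' ↔
      lS (σ' b) = lS (σ' b') ∧ lR (ρ' b) = lR (ρ' b')) :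
    SymbolicConjugate 𝒜 ℬ := by
  have hφ : ∀ x : 𝒜.edgeShift, ∃ y : ℬ.edgeShift,
      ∀ n, σ' (y.1 n) = σ (x.1 n) ∧ ρ' (y.1 n) = ρ (x.1 (n + 1)) := by
    intro x
    choose y hy using fun n => (adj _ _).1 (x.2 n)
    exact ⟨⟨y, fun n => (adj' _ _).2 ⟨x.1 (n + 1), (hy n).2.symm, (hy (n + 1)).1.symm⟩⟩, hy⟩
  choose φ hφ using hφ
  -- the inverse joins the second half of the edge `n - 1` to the first half of the edge `n`
  have hφ' : ∀ y : ℬ.edgeShift, ∃ x, φ x = y := by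
    intro y
    choose z hz using fun n => (adj' _ _).1 (y.2 n)
    have hz' : ∀ n, ρ (z (n - 1)) = ρ' (y.1 (n - 1)) ∧ σ (z (n - 1)) = σ' (y.1 n) := by
      intro n
      have := hz (n - 1)
      rwa [sub_add_cancel] at this
    refine ⟨⟨fun n => z (n - 1), fun n => (adj _ _).2 ⟨y.1 n, (hz' n).2.symm, ?_⟩⟩, ?_⟩
    · rw [(hz' (n + 1)).1, add_sub_cancel_right]
    · refine Subtype.ext (funext fun n => inj' _ _ ?_ ?_)
      · rw [(hφ _ n).1]; exact (hz' n).2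
      · rw [(hφ _ n).2]; simpa using (hz' (n + 1)).1
  -- the label of `φ x` depends on the label of `x` only, so `φ` induces a map of the label shifts
  have hlab : ∀ (x x' : 𝒜.edgeShift) (n : ℤ), 𝒜.label (x.1 n) = 𝒜.label (x'.1 n) →
      𝒜.label (x.1 (n + 1)) = 𝒜.label (x'.1 (n + 1)) →
      ℬ.label ((φ x).1 n) = ℬ.label ((φ x').1 n) := by
    intro x x' n h0 h1
    rw [lab', (hφ x n).1, (hφ x n).2, (hφ x' n).1, (hφ x' n).2]
    exact ⟨((lab _ _).1 h0).2, ((lab _ _).1 h1).1⟩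
  have hψ : ∀ v : 𝒜.labelShift, ∃ x, 𝒜.labelMap x = v := by
    rintro ⟨v, x, hx, rfl⟩
    exact ⟨⟨x, hx⟩, rfl⟩
  choose π hπ using hψ
  have hπ' : ∀ v n, 𝒜.label ((π v).1 n) = v.1 n := fun v n =>
    congrFun (congrArg Subtype.val (hπ v)) n
  refine ⟨φ, fun v => ℬ.labelMap (φ (π v)), ⟨?_, ⟨?_, hφ'⟩, ?_⟩, ⟨?_, ⟨?_, ?_⟩, ?_⟩, ?_⟩
  · let _ : TopologicalSpace 𝒜.Edge := ⊥
    let _ : TopologicalSpace ℬ.Edge := ⊥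
    have : DiscreteTopology 𝒜.Edge := ⟨rfl⟩
    have : DiscreteTopology ℬ.Edge := ⟨rfl⟩
    refine continuous_of_finite_window _ fun n => ⟨{n, n + 1}, fun x x' h => ?_⟩
    refine inj' _ _ ?_ ?_
    · rw [(hφ _ _).1, (hφ _ _).1, h n (by simp)]
    · rw [(hφ _ _).2, (hφ _ _).2, h (n + 1) (by simp)]
  · intro x x' h
    have key : ∀ n, σ (x.1 n) = σ (x'.1 n) ∧ ρ (x.1 (n + 1)) = ρ (x'.1 (n + 1)) := fun n => by
      rw [← (hφ x n).1, ← (hφ x n).2, h]; exact hφ x' n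
    refine Subtype.ext (funext fun n => inj _ _ ?_ (key n).1)
    simpa using (key (n - 1)).2
  · intro x x' h
    refine funext fun n => inj' _ _ ?_ ?_
    · simp [(hφ _ _).1, h]
    · simp [(hφ _ _).2, h, add_assoc]
  · let _ : TopologicalSpace A := ⊥
    let _ : TopologicalSpace B := ⊥
    have : DiscreteTopology A := ⟨rfl⟩
    have : DiscreteTopology B := ⟨rfl⟩
    refine continuous_of_finite_window _ fun n => ⟨{n, n + 1}, fun v v' h => ?_⟩
    refine hlab _ _ _ ?_ ?_
    · rw [hπ', hπ', h n (by simp)]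
    · rw [hπ', hπ', h (n + 1) (by simp)]
  · intro v v' h
    have key : ∀ n, lS (σ ((π v).1 n)) = lS (σ ((π v').1 n)) ∧
        lR (ρ ((π v).1 (n + 1))) = lR (ρ ((π v').1 (n + 1))) := fun n => by
      rw [← (hφ _ n).1, ← (hφ _ n).2, ← (hφ _ n).1, ← (hφ _ n).2]
      exact (lab' _ _).1 (congrFun (congrArg Subtype.val h) n)
    refine Subtype.ext (funext fun n => ?_)
    rw [← hπ', ← hπ']
    refine (lab _ _).2 ⟨?_, (key n).1⟩
    simpa using (key (n - 1)).2
  · rintro ⟨w, y, hy, rfl⟩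
    obtain ⟨x, hx⟩ := hφ' ⟨y, hy⟩
    refine ⟨𝒜.labelMap x, Subtype.ext (funext fun n => ?_)⟩
    refine (hlab _ x n (hπ' _ _) (hπ' _ _)).trans ?_
    rw [hx]
  · intro v v' h
    refine funext fun n => ?_
    have e : ∀ n, 𝒜.label ((π v').1 n) = 𝒜.label ((π v).1 (1 + n)) := fun n => by
      rw [hπ', hπ', h]; rfl
    have e0 := e n
    have e1 := e (n + 1)
    change ℬ.label ((φ (π v')).1 n) = ℬ.label ((φ (π v)).1 (1 + n))
    rw [lab', (hφ _ _).1, (hφ _ _).2, (hφ _ _).1, (hφ _ _).2]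
    rw [← add_assoc] at e1
    exact ⟨((lab _ _).1 e0).2, ((lab _ _).1 e1).1⟩
  · intro x
    exact Subtype.ext (funext fun n => hlab _ _ n (hπ' _ _) (hπ' _ _))

/-- Matrices whose letters are enumerated by a common set, with the same coincidences and
the same coefficients, are similar. -/
theorem similarMatrices_of_enumeration {P Q A B : Type u} {Ω : Type*} {M : Matrix P Q (A → ℕ)}
    {N : Matrix P Q (B → ℕ)} (f : Ω → A) (g : Ω → B)
    (hf : ∀ a ∈ letters M, ∃ ω, f ω = a) (hg : ∀ b ∈ letters N, ∃ ω, g ω = b)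
    (hfg : ∀ ω ω', f ω = f ω' ↔ g ω = g ω')
    (h : ∀ p q ω, M p q (f ω) = N p q (g ω)) : SimilarMatrices M N := by
  have hl : ∀ ω, f ω ∈ letters M ↔ g ω ∈ letters N := fun ω => by
    simp only [letters, Set.mem_ofPred_eq, h]
  choose s hs using hf
  choose t ht using hg
  refine ⟨⟨fun a => ⟨g (s a a.2), (hl _).1 (by rw [hs]; exact a.2)⟩,
    fun b => ⟨f (t b b.2), (hl _).2 (by rw [ht]; exact b.2)⟩, fun a => ?_, fun b => ?_⟩, ?_⟩
  · refine Subtype.ext (Eq.trans ((hfg _ _).2 ?_) (hs a a.2))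
    rw [ht]
  · refine Subtype.ext (Eq.trans ((hfg _ _).1 ?_) (ht b b.2))
    rw [hs]
  · intro p q a
    change M p q a = N p q (g (s a a.2))
    rw [← h, hs]

/-- The automaton of a square alphabetic matrix, with as many edges as the coefficients say. -/
def SquareMatrix.automaton (M : SquareMatrix.{u}) : Automaton M.Letter where
  State := M.Index
  Edge := Σ x : M.Index × M.Index × M.Letter, Fin (M.entries x.1 x.2.1 x.2.2)
  source e := e.1.1
  target e := e.1.2.1
  label e := e.1.2.2

/-- There are finitely many edges between any two states with any given label, so that the
cardinalities in the adjacency matrix are not junk values. -/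
def Automaton.LocallyFinite {A : Type u} (𝒜 : Automaton A) : Prop :=
  ∀ p q a, Finite {e : 𝒜.Edge // 𝒜.source e = p ∧ 𝒜.target e = q ∧ 𝒜.label e = a}

theorem Sigma.card_fiber {I : Type u} (n : I → ℕ) (P : (Σ x, Fin (n x)) → Prop) (x : I)
    (h : ∀ e, P e ↔ e.1 = x) : Finite {e // P e} ∧ Nat.card {e // P e} = n x := by
  have e : {e // P e} ≃ Fin (n x) := (Equiv.subtypeEquivRight h).trans (Equiv.sigmaSubtype x)
  exact ⟨Finite.of_equiv _ e.symm, by rw [Nat.card_congr e, Nat.card_fin]⟩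

theorem SquareMatrix.locallyFinite_automaton (M : SquareMatrix.{u}) :
    M.automaton.LocallyFinite := fun p q a =>
  (Sigma.card_fiber (fun x : M.Index × M.Index × M.Letter => M.entries x.1 x.2.1 x.2.2) _
    (p, q, a) fun e => by simp [automaton, Prod.ext_iff]).1

theorem SquareMatrix.adjacencyMatrix_automaton (M : SquareMatrix.{u}) :
    M.automaton.adjacencyMatrix = M := by
  obtain ⟨I, L, m⟩ := M
  simp only [Automaton.adjacencyMatrix, SquareMatrix.mk.injEq]
  refine ⟨rfl, trivial, heq_of_eq ?_⟩
  ext p q a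
  exact (Sigma.card_fiber (fun x : I × I × L => m x.1 x.2.1 x.2.2) _
    (p, q, a) fun e => by simp [automaton, Prod.ext_iff]).2

/-- The edges of an automaton whose matrix is similar to a product `R S` are the paths of length
two made of a half-edge counted by `R` and a half-edge counted by `S`. -/
theorem exists_equiv_halfEdges {A C D Q : Type u} [Fintype Q] (𝒜 : Automaton A)
    (hfin : 𝒜.LocallyFinite) (R : Matrix 𝒜.State Q (C → ℕ)) (S : Matrix Q 𝒜.State (D → ℕ))
    (h : SimilarMatrices 𝒜.adjacencyMatrix.entries (product R S)) :
    ∃ e : 𝒜.Edge ≃ {x : (Σ i : 𝒜.State × Q × C, Fin (R i.1 i.2.1 i.2.2)) ×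
        (Σ j : Q × 𝒜.State × D, Fin (S j.1 j.2.1 j.2.2)) // x.1.1.2.1 = x.2.1.1},
      (∀ a, 𝒜.source a = (e a).1.1.1.1 ∧ 𝒜.target a = (e a).1.2.1.2.1) ∧
      ∀ a a', 𝒜.label a = 𝒜.label a' ↔ (e a).1.1.1.2.2 = (e a').1.1.1.2.2 ∧
        (e a).1.2.1.2.2 = (e a').1.2.1.2.2 := by
  classical
  obtain ⟨f, hf⟩ := h
  have hmem : ∀ a : 𝒜.Edge, 𝒜.label a ∈ letters 𝒜.adjacencyMatrix.entries := fun a => by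
    refine ⟨𝒜.source a, 𝒜.target a, ?_⟩
    have := hfin (𝒜.source a) (𝒜.target a) (𝒜.label a)
    have : Nonempty {e : 𝒜.Edge // 𝒜.source e = 𝒜.source a ∧ 𝒜.target e = 𝒜.target a ∧
      𝒜.label e = 𝒜.label a} := ⟨a, rfl, rfl, rfl⟩
    exact Nat.card_pos.ne'
  -- Both sets are fibered over triples (source, target, two-letter word). It is enough to compare
  -- the cardinalities of the fibers.
  let F : 𝒜.Edge → 𝒜.State × 𝒜.State × C × D := fun a =>
    (𝒜.source a, 𝒜.target a, (f ⟨_, hmem a⟩).1)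
  let G : {x : (Σ i : 𝒜.State × Q × C, Fin (R i.1 i.2.1 i.2.2)) ×
        (Σ j : Q × 𝒜.State × D, Fin (S j.1 j.2.1 j.2.2)) // x.1.1.2.1 = x.2.1.1} →
      𝒜.State × 𝒜.State × C × D := fun x => (x.1.1.1.1, x.1.2.1.2.1, x.1.1.1.2.2, x.1.2.1.2.2)
  have hG : ∀ p r c d, Nonempty ({x // G x = (p, r, c, d)} ≃ Fin (product R S p r (c, d))) := by
    intro p r c d
    have e1 : {x // G x = (p, r, c, d)} ≃ Σ q : Q, Fin (R p q c) × Fin (S q r d) :=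
      { toFun := fun x => ⟨x.1.1.1.1.2.1,
          Fin.cast (by have := x.2; simp only [G, Prod.mk.injEq] at this; simp [← this.1,
            ← this.2.2.1]) x.1.1.1.2,
          Fin.cast (by have := x.2; have h2 := x.1.2; simp only [G, Prod.mk.injEq] at this
                       simp [h2, ← this.2.1, ← this.2.2.2]) x.1.1.2.2⟩
        invFun := fun y => ⟨⟨⟨⟨(p, y.1, c), y.2.1⟩, ⟨(y.1, r, d), y.2.2⟩⟩, rfl⟩, rfl⟩
        left_inv := by
          rintro ⟨⟨⟨⟨⟨p', q', c'⟩, i⟩, ⟨⟨q'', r', d'⟩, j⟩⟩, h⟩, h'⟩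
          simp only [G, Prod.mk.injEq] at h'
          obtain ⟨rfl, rfl, rfl, rfl⟩ := h'
          dsimp only at h
          subst h
          rfl
        right_inv := by rintro ⟨q, i, j⟩; rfl }
    refine ⟨e1.trans (Fintype.equivFinOfCardEq ?_)⟩
    simp [product]
  have hFG : ∀ i, Nonempty ({a // F a = i} ≃ {x // G x = i}) := by
    rintro ⟨p, r, c, d⟩
    obtain ⟨g⟩ := hG p r c d
    by_cases hcd : (c, d) ∈ letters (product R S)
    · have hfa := hf p r (f.symm ⟨_, hcd⟩)
      rw [Equiv.apply_symm_apply] at hfa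
      have := hfin p r (f.symm ⟨_, hcd⟩).1
      have e2 : {a // F a = (p, r, c, d)} ≃ {e : 𝒜.Edge // 𝒜.source e = p ∧ 𝒜.target e = r ∧
          𝒜.label e = (f.symm ⟨_, hcd⟩).1} := by
        refine Equiv.subtypeEquivRight fun a => ?_
        simp only [F, Prod.mk.injEq]
        refine and_congr_right fun _ => and_congr_right fun _ => ?_
        change _ = _ ↔ (⟨𝒜.label a, hmem a⟩ : letters 𝒜.adjacencyMatrix.entries).1 = _
        rw [← Subtype.ext_iff, Equiv.eq_symm_apply, Subtype.ext_iff]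
      exact ⟨e2.trans ((Finite.equivFinOfCardEq hfa).trans g.symm)⟩
    · have h1 : IsEmpty {x // G x = (p, r, c, d)} := by
        have : product R S p r (c, d) = 0 := by
          by_contra h0
          exact hcd ⟨p, r, h0⟩
        rw [this] at g
        exact g.isEmpty
      have h2 : IsEmpty {a // F a = (p, r, c, d)} := ⟨fun a => hcd (by
        have := a.2
        simp only [F, Prod.mk.injEq] at this
        rw [← this.2.2]
        exact Subtype.coe_prop _)⟩
      exact ⟨Equiv.equivOfIsEmpty _ _⟩
  let e := Equiv.ofFiberEquiv fun i => (hFG i).some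
  have he : ∀ a, G (e a) = F a := Equiv.ofFiberEquiv_map _
  refine ⟨e, fun a => ?_, fun a a' => ?_⟩
  · have := he a
    simp only [F, G, Prod.mk.injEq] at this
    exact ⟨this.1.symm, this.2.1.symm⟩
  · have h1 := he a
    have h2 := he a'
    simp only [F, G, Prod.mk.injEq] at h1 h2
    rw [← Prod.mk.injEq, h1.2.2, h2.2.2, ← Subtype.ext_iff, f.injective.eq_iff, Subtype.ext_iff]
    rfl

/-- If `M = R S` and `N = S R` up to similarity, then two consecutive edges `ρ σ` and `ρ' σ'` of the
automaton of `M` give an edge `σ ρ'` of the automaton of `N`, and conversely. -/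
theorem SymbolicElementaryEquivalent.symbolicConjugate {A B : Type u} {𝒜 : Automaton A}
    {ℬ : Automaton B} (hA : 𝒜.LocallyFinite) (hB : ℬ.LocallyFinite)
    (h : SymbolicElementaryEquivalent 𝒜.adjacencyMatrix ℬ.adjacencyMatrix) :
    SymbolicConjugate 𝒜 ℬ := by
  obtain ⟨_, _, _, _, C, D, _, _, R, S, hM, hN⟩ := h
  obtain ⟨e, he, hl⟩ := exists_equiv_halfEdges 𝒜 hA R S hM
  obtain ⟨e', he', hl'⟩ := exists_equiv_halfEdges ℬ hB S R hN
  refine symbolicConjugate_of_halfEdges (fun a => (e a).1.1) (fun a => (e a).1.2)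
    (fun b => (e' b).1.1) (fun b => (e' b).1.2) (fun r => r.1.2.2) (fun s => s.1.2.2)
    (fun a a' h1 h2 => e.injective (Subtype.ext (Prod.ext h1 h2)))
    (fun a a' h1 h2 => e'.injective (Subtype.ext (Prod.ext h1 h2)))
    (fun a a' => ?_) (fun b b' => ?_) hl hl'
  · rw [(he a).2, (he a').1]
    constructor
    · intro h
      exact ⟨e'.symm ⟨((e a).1.2, (e a').1.1), h⟩, by rw [Equiv.apply_symm_apply],
        by rw [Equiv.apply_symm_apply]⟩
    · rintro ⟨b, h1, h2⟩
      rw [← h1, ← h2]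
      exact (e' b).2
  · rw [(he' b).2, (he' b').1]
    constructor
    · intro h
      exact ⟨e.symm ⟨((e' b).1.2, (e' b').1.1), h⟩, by rw [Equiv.apply_symm_apply],
        by rw [Equiv.apply_symm_apply]⟩
    · rintro ⟨a, h1, h2⟩
      rw [← h1, ← h2]
      exact (e a).2

/-- A matrix is the product of itself and an identity matrix over a one-letter alphabet. -/
theorem SymbolicElementaryEquivalent.refl (M : SquareMatrix.{u}) [Finite M.Index]
    [Finite M.Letter] : SymbolicElementaryEquivalent M M := by
  classical
  have := Fintype.ofFinite M.Index
  refine ⟨this, this, ‹_›, ‹_›, M.Letter, PUnit, ‹_›, inferInstance, M.entries,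
    Matrix.of fun p q _ => if p = q then 1 else 0, ?_, ?_⟩
  · exact similarMatrices_of_enumeration id (fun a => (a, PUnit.unit)) (fun a _ => ⟨a, rfl⟩)
      (fun b _ => ⟨b.1, rfl⟩) (by simp) (by simp [product])
  · exact similarMatrices_of_enumeration id (fun a => (PUnit.unit, a)) (fun a _ => ⟨a, rfl⟩)
      (fun b _ => ⟨b.2, rfl⟩) (by simp) (by simp [product])

theorem SymbolicStrongShiftEquivalent.symbolicConjugate {A B : Type u} [Finite A]
    {𝒜 : Automaton A} {ℬ : Automaton B} [Finite 𝒜.State]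
    (hA : 𝒜.LocallyFinite) (hB : ℬ.LocallyFinite)
    (h : SymbolicStrongShiftEquivalent 𝒜.adjacencyMatrix ℬ.adjacencyMatrix) :
    SymbolicConjugate 𝒜 ℬ := by
  have key : ∀ N, SymbolicStrongShiftEquivalent 𝒜.adjacencyMatrix N →
      ∀ {B : Type u} (ℬ : Automaton B), ℬ.LocallyFinite → ℬ.adjacencyMatrix = N →
        SymbolicConjugate 𝒜 ℬ := by
    intro N hN
    induction hN with
    | refl =>
      -- equal matrices still leave two automata, which one more elementary step identifies
      intro B ℬ hB h
      have : Finite 𝒜.adjacencyMatrix.Index := ‹Finite 𝒜.State›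
      have : Finite 𝒜.adjacencyMatrix.Letter := ‹Finite A›
      have hr := SymbolicElementaryEquivalent.refl 𝒜.adjacencyMatrix
      nth_rewrite 2 [← h] at hr
      exact hr.symbolicConjugate hA hB
    | @tail M N _ hMN ih =>
      intro B ℬ hB h
      refine (ih M.automaton M.locallyFinite_automaton M.adjacencyMatrix_automaton).trans ?_
      refine SymbolicElementaryEquivalent.symbolicConjugate M.locallyFinite_automaton hB ?_
      rwa [M.adjacencyMatrix_automaton, h]
  exact key _ h ℬ hB rfl

/-! ### Codings of an invertible system and their Krieger states -/

/-- The itinerary of `ω` under `T` as seen through the coding `α`. -/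
def coded {Ω A : Type u} (T : Equiv.Perm Ω) (α : Ω → A) (ω : Ω) : ℤ → A := fun n => α ((T ^ n) ω)

/-- The shift space of all itineraries of the coding `α`. -/
def codedShift {Ω A : Type u} (T : Equiv.Perm Ω) (α : Ω → A) : Set (ℤ → A) :=
  Set.range (coded T α)

/-- The past of `ω`, as a left infinite word (the most recent letter has index `0`). -/
def past {Ω A : Type u} (T : Equiv.Perm Ω) (α : Ω → A) (ω : Ω) : ℕ → A :=
  fun n => coded T α ω (Int.negSucc n)

/-- The future of `ω`, the present included. -/
def future {Ω A : Type u} (T : Equiv.Perm Ω) (α : Ω → A) (ω : Ω) : ℕ → A :=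
  fun n => coded T α ω n

/-- The right contexts of the past of `ω`. -/
def context {Ω A : Type u} (T : Equiv.Perm Ω) (α : Ω → A) (ω : Ω) : Set (ℕ → A) :=
  rightContexts (codedShift T α) (past T α ω)

section Coding

variable {Ω A : Type u} (T : Equiv.Perm Ω) (α : Ω → A)

theorem join_eq_iff (x : ℤ → A) (y z : ℕ → A) :
    x = join y z ↔ (fun n : ℕ => x (Int.negSucc n)) = y ∧ (fun n : ℕ => x n) = z := by
  constructor
  · rintro rfl
    exact ⟨rfl, rfl⟩
  · rintro ⟨rfl, rfl⟩
    ext (n | n) <;> rfl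

theorem join_mem_codedShift (y z : ℕ → A) :
    join y z ∈ codedShift T α ↔ ∃ ω, past T α ω = y ∧ future T α ω = z := by
  simp only [codedShift, Set.mem_range, join_eq_iff]
  rfl

theorem mem_context {ω : Ω} {z : ℕ → A} :
    z ∈ context T α ω ↔ ∃ ω', past T α ω' = past T α ω ∧ future T α ω' = z :=
  join_mem_codedShift _ _ _ _

/-- Points with the same Krieger state can exchange their futures. -/
theorem exists_of_context_eq {ω ω' : Ω} (h : context T α ω = context T α ω') :
    ∃ ω'', past T α ω'' = past T α ω ∧ future T α ω'' = future T α ω' := by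
  rw [← mem_context, h, mem_context]
  exact ⟨ω', rfl, rfl⟩

theorem coded_apply (ω : Ω) (n : ℤ) : coded T α (T ω) n = coded T α ω (n + 1) := by
  simp [coded, zpow_add_one]

theorem coded_comp (ω : Ω) : coded T (α ∘ T) ω = coded T α (T ω) := by
  ext n
  rw [coded_apply]
  simp [coded, add_comm n 1, zpow_add]

theorem codedShift_comp : codedShift T (α ∘ T) = codedShift T α := by
  have : coded T (α ∘ T) = coded T α ∘ T := funext (coded_comp T α)
  rw [codedShift, this, Set.range_comp, T.surjective.range_eq, Set.image_univ]
  rfl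

theorem context_comp (ω : Ω) : context T (α ∘ T) ω = context T α (T ω) := by
  simp only [context, codedShift_comp]
  unfold past
  rw [coded_comp]

theorem past_apply (ω : Ω) : past T α (T ω) = append (past T α ω) (α ω) := by
  ext (_ | n)
  · simp [past, append, coded]
  · exact coded_apply T α ω _

theorem future_zero (ω : Ω) : future T α ω 0 = α ω := by simp [future, coded]

/-- The state of the Krieger automaton reached after the past of `ω`. -/
def kriegerState (ω : Ω) : (krieger (codedShift T α)).State :=
  ⟨context T α ω, ⟨future T α ω, (mem_context T α).2 ⟨ω, rfl, rfl⟩⟩, past T α ω, rfl⟩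

theorem exists_kriegerState (p : (krieger (codedShift T α)).State) :
    ∃ ω, p = kriegerState T α ω := by
  obtain ⟨p, ⟨z, hz⟩, y, rfl⟩ := p
  obtain ⟨ω, rfl, -⟩ := (join_mem_codedShift T α y z).1 hz
  exact ⟨ω, rfl⟩

/-- There is an edge labeled `a` from `p` to `r` in the Krieger automaton. -/
def KriegerStep (p : Set (ℕ → A)) (a : A) (r : Set (ℕ → A)) : Prop :=
  ∃ ω, p = context T α ω ∧ a = α ω ∧ r = context T α (T ω)

theorem kriegerStep_iff (p r : (krieger (codedShift T α)).State) (a : A) :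
    KriegerStep T α p.1 a r.1 ↔ ∃ e : (krieger (codedShift T α)).Edge,
      (krieger (codedShift T α)).source e = p ∧ (krieger (codedShift T α)).target e = r ∧
        (krieger (codedShift T α)).label e = a := by
  constructor
  · rintro ⟨ω, hp, rfl, hr⟩
    exact ⟨⟨(p, α ω, r), past T α ω, hp, hr.trans (by rw [context, past_apply])⟩, rfl, rfl, rfl⟩
  · rintro ⟨⟨⟨p', a', r'⟩, y, hp, hr⟩, rfl, rfl, rfl⟩
    obtain ⟨z, hz⟩ := r'.2.1
    simp only at hp hr
    rw [hr] at hz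
    obtain ⟨ω, h, -⟩ := (join_mem_codedShift T α _ z).1 hz
    obtain ⟨ω, rfl⟩ := T.surjective ω
    rw [past_apply] at h
    have h0 := congrFun h 0
    have h1 : past T α ω = y := funext fun n => congrFun h (n + 1)
    refine ⟨ω, ?_, h0.symm, ?_⟩
    · rw [context, h1]; exact hp
    · rw [context, past_apply, h]; exact hr

end Coding

theorem subsingleton_krieger_edges {A : Type u} (X : Set (ℤ → A)) (p r : (krieger X).State)
    (a : A) : Subsingleton {e : (krieger X).Edge // (krieger X).source e = p ∧
      (krieger X).target e = r ∧ (krieger X).label e = a} := by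
  refine ⟨fun ⟨e, h1, h2, h3⟩ ⟨e', h1', h2', h3'⟩ => Subtype.ext (Subtype.ext ?_)⟩
  exact Prod.ext (h1.trans h1'.symm) (Prod.ext (h3.trans h3'.symm) (h2.trans h2'.symm))

theorem subsingleton_restrict_edges {A : Type u} (𝒜 : Automaton A) (S : Set 𝒜.State)
    (h : ∀ p r a, Subsingleton {e : 𝒜.Edge // 𝒜.source e = p ∧ 𝒜.target e = r ∧ 𝒜.label e = a})
    (p r : (𝒜.restrict S).State) (a : A) : Subsingleton {e : (𝒜.restrict S).Edge //
      (𝒜.restrict S).source e = p ∧ (𝒜.restrict S).target e = r ∧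
        (𝒜.restrict S).label e = a} := by
  refine ⟨fun ⟨e, h1, h2, h3⟩ ⟨e', h1', h2', h3'⟩ => Subtype.ext (Subtype.ext ?_)⟩
  have key := (h p.1 r.1 a).elim
    ⟨e.1, congrArg Subtype.val h1, congrArg Subtype.val h2, h3⟩
    ⟨e'.1, congrArg Subtype.val h1', congrArg Subtype.val h2', h3'⟩
  have := congrArg Subtype.val key
  exact this

theorem Automaton.locallyFinite_of_subsingleton {A : Type u} (𝒜 : Automaton A)
    (h : ∀ p r a, Subsingleton {e : 𝒜.Edge //
      𝒜.source e = p ∧ 𝒜.target e = r ∧ 𝒜.label e = a}) : 𝒜.LocallyFinite := fun p r a =>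
  have := h p r a
  inferInstance

open Classical in
theorem Automaton.entries_of_subsingleton {A : Type u} (𝒜 : Automaton A)
    (h : ∀ p r a, Subsingleton {e : 𝒜.Edge //
      𝒜.source e = p ∧ 𝒜.target e = r ∧ 𝒜.label e = a}) (p r : 𝒜.State) (a : A) :
    𝒜.adjacencyMatrix.entries p r a =
      if ∃ e : 𝒜.Edge, 𝒜.source e = p ∧ 𝒜.target e = r ∧ 𝒜.label e = a then 1 else 0 := by
  have := h p r a
  change Nat.card {e : 𝒜.Edge // 𝒜.source e = p ∧ 𝒜.target e = r ∧ 𝒜.label e = a} = _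
  split_ifs with he
  · obtain ⟨e, he⟩ := he
    have : Nonempty {e : 𝒜.Edge // 𝒜.source e = p ∧ 𝒜.target e = r ∧ 𝒜.label e = a} := ⟨e, he⟩
    exact Nat.card_unique
  · have : IsEmpty {e : 𝒜.Edge // 𝒜.source e = p ∧ 𝒜.target e = r ∧ 𝒜.label e = a} :=
      ⟨fun e => he ⟨e.1, e.2⟩⟩
    exact Nat.card_of_isEmpty

/-! ### Bipartite codings -/

/-- The letters of the coding `α` are words `c d` of half-letters, and those of `α'` are the words
`d c` obtained by moving the brackets by half a letter. -/
structure Bipartite {Ω A A' C D : Type u} (T : Equiv.Perm Ω) (α : Ω → A) (α' : Ω → A')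
    (c : Ω → C) (d : Ω → D) : Prop where
  left : ∀ ω ω', α ω = α ω' ↔ c ω = c ω' ∧ d ω = d ω'
  right : ∀ ω ω', α' ω = α' ω' ↔ d ω = d ω' ∧ c (T ω) = c (T ω')

/-- The half-step `p → q` reading the half-letter `x` leads from the state of `ω` for `α` to the
state of the same `ω` for `α'`, whose past is longer by one half-letter. -/
def HalfStep {Ω A A' C : Type u} (T : Equiv.Perm Ω) (α : Ω → A) (α' : Ω → A') (c : Ω → C)
    (p : Set (ℕ → A)) (x : C) (q : Set (ℕ → A')) : Prop :=
  ∃ ω, p = context T α ω ∧ x = c ω ∧ q = context T α' ω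

namespace Bipartite

variable {Ω A A' C D : Type u} {T : Equiv.Perm Ω} {α : Ω → A} {α' : Ω → A'} {c : Ω → C} {d : Ω → D}

theorem swap (h : Bipartite T α α' c d) : Bipartite T α' (α ∘ T) d (c ∘ T) :=
  ⟨h.right, fun _ _ => h.left _ _⟩

theorem coded_left (h : Bipartite T α α' c d) {ω ω' : Ω} {n : ℤ} :
    coded T α ω n = coded T α ω' n ↔
      coded T c ω n = coded T c ω' n ∧ coded T d ω n = coded T d ω' n := h.left _ _

theorem coded_right (h : Bipartite T α α' c d) {ω ω' : Ω} {n : ℤ} :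
    coded T α' ω n = coded T α' ω' n ↔
      coded T d ω n = coded T d ω' n ∧ coded T c ω (n + 1) = coded T c ω' (n + 1) := by
  have := h.right ((T ^ n) ω) ((T ^ n) ω')
  simpa [coded, add_comm n 1, zpow_add] using this

/-- The past for `α'` is the past for `α` followed by the current half-letter. -/
theorem past_eq_iff (h : Bipartite T α α' c d) {ω ω' : Ω} :
    past T α' ω = past T α' ω' ↔ past T α ω = past T α ω' ∧ c ω = c ω' := by
  have h0 : ∀ ω, c ω = coded T c ω 0 := fun ω => by simp [coded]
  have h1 : ∀ n : ℕ, Int.negSucc (n + 1) + 1 = Int.negSucc n := fun n => by lia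
  constructor
  · intro hp
    have hp' : ∀ n : ℕ, _ := fun n => h.coded_right.1 (congrFun hp n)
    refine ⟨funext fun n => h.coded_left.2 ⟨?_, (hp' n).1⟩, ?_⟩
    · have := (hp' (n + 1)).2
      rwa [h1] at this
    · rw [h0, h0]
      exact (hp' 0).2
  · rintro ⟨hp, hc⟩
    have hp' : ∀ n : ℕ, _ := fun n => h.coded_left.1 (congrFun hp n)
    refine funext fun n => h.coded_right.2 ⟨(hp' n).2, ?_⟩
    cases n with
    | zero => rw [h0, h0] at hc; exact hc
    | succ n => rw [h1]; exact (hp' n).1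

theorem future_eq (h : Bipartite T α α' c d) {ω ω' : Ω} (hf : future T α ω = future T α ω') :
    future T α' ω = future T α' ω' := by
  have hf' : ∀ n : ℕ, _ := fun n => h.coded_left.1 (congrFun hf n)
  exact funext fun n => h.coded_right.2 ⟨(hf' n).2, by exact_mod_cast (hf' (n + 1)).1⟩

/-- Half-steps are deterministic. -/
theorem context_eq (h : Bipartite T α α' c d) {ω ω' : Ω} (hω : context T α ω = context T α ω')
    (hc : c ω = c ω') : context T α' ω = context T α' ω' := by
  have key : ∀ {ω ω' : Ω}, context T α ω = context T α ω' → c ω = c ω' →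
      context T α' ω ⊆ context T α' ω' := by
    intro ω ω' hω hc z hz
    obtain ⟨ω₁, hp, rfl⟩ := (mem_context T α').1 hz
    rw [h.past_eq_iff] at hp
    have : future T α ω₁ ∈ context T α ω' := hω ▸ (mem_context T α).2 ⟨ω₁, hp.1, rfl⟩
    obtain ⟨ω₂, hp₂, hf₂⟩ := (mem_context T α).1 this
    refine (mem_context T α').2 ⟨ω₂, h.past_eq_iff.2 ⟨hp₂, ?_⟩, h.future_eq hf₂⟩
    have := congrFun hf₂ 0
    rw [future_zero, future_zero, h.left] at this
    exact this.1.trans (hp.2.trans hc)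
  exact (key hω hc).antisymm (key hω.symm hc.symm)

theorem halfStep_unique (h : Bipartite T α α' c d) {p : Set (ℕ → A)} {x : C} {q q' : Set (ℕ → A')}
    (hq : HalfStep T α α' c p x q) (hq' : HalfStep T α α' c p x q') : q = q' := by
  obtain ⟨ω, rfl, rfl, rfl⟩ := hq
  obtain ⟨ω', hp, hc, rfl⟩ := hq'
  exact h.context_eq hp hc

/-- Consecutive half-steps are realized by a single point of the system. -/
theorem exists_of_halfSteps (h : Bipartite T α α' c d) {p r : Set (ℕ → A)} {q : Set (ℕ → A')}
    {x : C} {y : D} (h1 : HalfStep T α α' c p x q) (h2 : HalfStep T α' (α ∘ T) d q y r) :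
    ∃ ω, p = context T α ω ∧ x = c ω ∧ q = context T α' ω ∧ y = d ω ∧ r = context T α (T ω) := by
  obtain ⟨ω, rfl, rfl, rfl⟩ := h1
  obtain ⟨ω', hq, rfl, rfl⟩ := h2
  obtain ⟨ω'', hp, hf⟩ := exists_of_context_eq T α' hq
  have hc : context T α' ω'' = context T α' ω := by rw [context, hp]; rfl
  have hd : d ω'' = d ω' := by
    have := congrFun hf 0
    rw [future_zero, future_zero, h.right] at this
    exact this.1
  rw [h.past_eq_iff] at hp
  refine ⟨ω'', ?_, hp.2.symm, hc.symm, hd.symm, ?_⟩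
  · rw [context, context, hp.1]
  · rw [← context_comp]
    exact (h.swap.context_eq (hc.trans hq) hd).symm

/-- An edge of the Krieger automaton of `α` is a pair of consecutive half-steps. -/
theorem kriegerStep_iff (h : Bipartite T α α' c d) (p r : Set (ℕ → A)) (ω : Ω) :
    KriegerStep T α p (α ω) r ↔
      ∃ q, HalfStep T α α' c p (c ω) q ∧ HalfStep T α' (α ∘ T) d q (d ω) r := by
  constructor
  · rintro ⟨ω', rfl, hω, rfl⟩
    rw [h.left] at hω
    exact ⟨_, ⟨ω', rfl, hω.1, rfl⟩, ⟨ω', rfl, hω.2, (context_comp T α ω').symm⟩⟩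
  · rintro ⟨q, h1, h2⟩
    obtain ⟨ω', hp, hc, -, hd, hr⟩ := h.exists_of_halfSteps h1 h2
    exact ⟨ω', hp, (h.left _ _).2 ⟨hc, hd⟩, hr⟩

theorem halfStep_comp {p : Set (ℕ → A)} {x : C} {q : Set (ℕ → A')} :
    HalfStep T (α ∘ T) (α' ∘ T) (c ∘ T) p x q ↔ HalfStep T α α' c p x q := by
  simp only [HalfStep, context_comp, Function.comp_apply]
  exact (T.surjective.exists (p := fun ω => p = context T α ω ∧ x = c ω ∧
    q = context T α' ω)).symm

/-- An edge of the Krieger automaton of `α'` is a pair of consecutive half-steps in the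
opposite order. -/
theorem kriegerStep_iff' (h : Bipartite T α α' c d) (q s : Set (ℕ → A')) (ω : Ω) :
    KriegerStep T α' q (α' ω) s ↔
      ∃ p, HalfStep T α' (α ∘ T) d q (d ω) p ∧ HalfStep T α α' c p (c (T ω)) s := by
  rw [h.swap.kriegerStep_iff]
  simp only [halfStep_comp, Function.comp_apply]

/-- Two automata whose states are Krieger states of bipartite codings, whose edges are all the
edges of the Krieger automata between these states, and whose sets of states are closed under
half-steps, have symbolic elementary equivalent adjacency matrices. -/
theorem elementaryEquivalent [Finite A] [Finite A'] [Finite C] [Finite D]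
    (h : Bipartite T α α' c d) {𝒜 : Automaton A} {ℬ : Automaton A'} [Finite 𝒜.State]
    [Finite ℬ.State] (s : 𝒜.State → Set (ℕ → A)) (s' : ℬ.State → Set (ℕ → A'))
    (hs : Function.Injective s) (hs' : Function.Injective s')
    (sub : ∀ p r a, Subsingleton {e : 𝒜.Edge //
      𝒜.source e = p ∧ 𝒜.target e = r ∧ 𝒜.label e = a})
    (sub' : ∀ p r a, Subsingleton {e : ℬ.Edge //
      ℬ.source e = p ∧ ℬ.target e = r ∧ ℬ.label e = a})
    (edge : ∀ p r a, (∃ e : 𝒜.Edge, 𝒜.source e = p ∧ 𝒜.target e = r ∧ 𝒜.label e = a) ↔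
      KriegerStep T α (s p) a (s r))
    (edge' : ∀ p r a, (∃ e : ℬ.Edge, ℬ.source e = p ∧ ℬ.target e = r ∧ ℬ.label e = a) ↔
      KriegerStep T α' (s' p) a (s' r))
    (closed : ∀ p x q, HalfStep T α α' c (s p) x q → ∃ q', s' q' = q)
    (closed' : ∀ q y p, HalfStep T α' (α ∘ T) d (s' q) y p → ∃ p', s p' = p) :
    SymbolicElementaryEquivalent 𝒜.adjacencyMatrix ℬ.adjacencyMatrix := by
  classical
  let F : Fintype 𝒜.State := Fintype.ofFinite _
  let F' : Fintype ℬ.State := Fintype.ofFinite _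
  let R : Matrix 𝒜.State ℬ.State (C → ℕ) :=
    Matrix.of fun p q x => if HalfStep T α α' c (s p) x (s' q) then 1 else 0
  let S : Matrix ℬ.State 𝒜.State (D → ℕ) :=
    Matrix.of fun q p y => if HalfStep T α' (α ∘ T) d (s' q) y (s p) then 1 else 0
  -- by determinism at most one summand of an entry of a product is nonzero
  have hRS : ∀ p r x y, product R S p r (x, y) = if ∃ q, HalfStep T α α' c (s p) x (s' q) ∧
      HalfStep T α' (α ∘ T) d (s' q) y (s r) then 1 else 0 := by
    intro p r x y
    simp only [product, Matrix.of_apply, R, S, ← ite_and, mul_ite, mul_one, mul_zero]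
    split_ifs with hq
    · obtain ⟨q, h1, h2⟩ := hq
      rw [Finset.sum_eq_single q, if_pos ⟨h2, h1⟩]
      · intro q' _ hne
        exact if_neg fun hq' => hne (hs' (h.halfStep_unique hq'.2 h1))
      · simp
    · exact Finset.sum_eq_zero fun q _ => if_neg fun h' => hq ⟨q, h'.2, h'.1⟩
  have hSR : ∀ q r y x, product S R q r (y, x) = if ∃ p,
      HalfStep T α' (α ∘ T) d (s' q) y (s p) ∧ HalfStep T α α' c (s p) x (s' r)
      then 1 else 0 := by
    intro q r y x
    simp only [product, Matrix.of_apply, R, S, ← ite_and, mul_ite, mul_one, mul_zero]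
    split_ifs with hp
    · obtain ⟨p, h1, h2⟩ := hp
      rw [Finset.sum_eq_single p, if_pos ⟨h2, h1⟩]
      · intro p' _ hne
        exact if_neg fun hp' => hne (hs (h.swap.halfStep_unique hp'.2 h1))
      · simp
    · exact Finset.sum_eq_zero fun p _ => if_neg fun h' => hp ⟨p, h'.2, h'.1⟩
  obtain ⟨m, hm, hme⟩ : ∃ m : Matrix 𝒜.State 𝒜.State (A → ℕ), m = 𝒜.adjacencyMatrix.entries ∧
      ∀ p r a, m p r a = if KriegerStep T α (s p) a (s r) then 1 else 0 :=
    ⟨_, rfl, fun p r a => by simp only [𝒜.entries_of_subsingleton sub, edge]⟩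
  obtain ⟨m', hm', hme'⟩ : ∃ m : Matrix ℬ.State ℬ.State (A' → ℕ), m = ℬ.adjacencyMatrix.entries ∧
      ∀ p r a, m p r a = if KriegerStep T α' (s' p) a (s' r) then 1 else 0 :=
    ⟨_, rfl, fun p r a => by simp only [ℬ.entries_of_subsingleton sub', edge']⟩
  have hM : SimilarMatrices m (product R S) := by
    refine similarMatrices_of_enumeration α (fun ω => (c ω, d ω)) ?_ ?_ ?_ ?_
    · rintro a ⟨p, r, ha⟩
      rw [hme] at ha
      obtain ⟨ω, -, rfl, -⟩ := (ite_ne_right_iff.1 ha).1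
      exact ⟨ω, rfl⟩
    · rintro ⟨x, y⟩ ⟨p, r, hxy⟩
      rw [hRS] at hxy
      obtain ⟨q, h1, h2⟩ := (ite_ne_right_iff.1 hxy).1
      obtain ⟨ω, -, rfl, -, rfl, -⟩ := h.exists_of_halfSteps h1 h2
      exact ⟨ω, rfl⟩
    · intro ω ω'
      rw [h.left, Prod.mk.injEq]
    · intro p r ω
      rw [hme, hRS, h.kriegerStep_iff]
      refine if_congr ⟨?_, ?_⟩ rfl rfl
      · rintro ⟨q, h1, h2⟩
        obtain ⟨q, rfl⟩ := closed _ _ _ h1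
        exact ⟨q, h1, h2⟩
      · rintro ⟨q, h1, h2⟩
        exact ⟨_, h1, h2⟩
  have hN : SimilarMatrices m' (product S R) := by
    refine similarMatrices_of_enumeration α' (fun ω => (d ω, c (T ω))) ?_ ?_ ?_ ?_
    · rintro a ⟨p, r, ha⟩
      rw [hme'] at ha
      obtain ⟨ω, -, rfl, -⟩ := (ite_ne_right_iff.1 ha).1
      exact ⟨ω, rfl⟩
    · rintro ⟨y, x⟩ ⟨q, r, hxy⟩
      rw [hSR] at hxy
      obtain ⟨p, h1, h2⟩ := (ite_ne_right_iff.1 hxy).1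
      obtain ⟨ω, -, rfl, -, rfl, -⟩ := h.swap.exists_of_halfSteps h1 (halfStep_comp.2 h2)
      exact ⟨ω, rfl⟩
    · intro ω ω'
      rw [h.right, Prod.mk.injEq]
    · intro q r ω
      rw [hme', hSR, h.kriegerStep_iff']
      refine if_congr ⟨?_, ?_⟩ rfl rfl
      · rintro ⟨p, h1, h2⟩
        obtain ⟨p, rfl⟩ := closed' _ _ _ h1
        exact ⟨p, h1, h2⟩
      · rintro ⟨p, h1, h2⟩
        exact ⟨_, h1, h2⟩
  exact ⟨F, F', ‹_›, ‹_›, C, D, ‹_›, ‹_›, R, S, hm ▸ hM, hm' ▸ hN⟩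

end Bipartite

/-! ### Minimal components -/

/-- The minimal components consist of the states to which one can always return. -/
theorem Automaton.mem_minimalComponent_iff {A : Type u} (𝒜 : Automaton A) (p : 𝒜.State) :
    (∃ S, 𝒜.IsMinimalComponent S ∧ p ∈ S) ↔ ∀ q, 𝒜.Reachable p q → 𝒜.Reachable q p := by
  constructor
  · rintro ⟨S, ⟨⟨p₀, rfl⟩, hS⟩, hp⟩ q hq
    have : 𝒜.Reachable p₀ q ∧ 𝒜.Reachable q p₀ := by
      induction hq with
      | refl => exact hp
      | tail _ h ih =>
        obtain ⟨e, rfl, rfl⟩ := h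
        exact hS e ih
    exact this.2.trans hp.1
  · intro h
    refine ⟨_, ⟨⟨p, rfl⟩, fun e he => ?_⟩, .refl, .refl⟩
    have hpe : 𝒜.Reachable p (𝒜.target e) := he.1.tail ⟨e, rfl, rfl⟩
    exact ⟨hpe, h _ hpe⟩

/-- In a bipartite graph with half-steps `R` and `S`, let `E` and `E'` be the graphs of double steps
on the two sides. If everything reachable from `p` leads back to `p`, then the same holds for each
half-step successor `q` of `p`. -/
theorem reflTransGen_symm_of_halfStep {P Q : Type*} {E : P → P → Prop} {E' : Q → Q → Prop}
    {R : P → Q → Prop} {S : Q → P → Prop} (hE : ∀ p r, E p r ↔ ∃ q, R p q ∧ S q r)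
    (hE' : ∀ q s, E' q s ↔ ∃ p, S q p ∧ R p s) (hS : ∀ q, ∃ p, S q p) {p : P} {q : Q}
    (hp : ∀ p', Relation.ReflTransGen E p p' → Relation.ReflTransGen E p' p) (hpq : R p q)
    (s : Q) (hqs : Relation.ReflTransGen E' q s) : Relation.ReflTransGen E' s q := by
  have h1 : ∃ p', Relation.ReflTransGen E p p' ∧ R p' s := by
    induction hqs with
    | refl => exact ⟨p, .refl, hpq⟩
    | tail _ h ih =>
      obtain ⟨p', hp', hR⟩ := ih
      obtain ⟨p'', hS', hR'⟩ := (hE' _ _).1 h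
      exact ⟨p'', hp'.tail ((hE _ _).2 ⟨_, hR, hS'⟩), hR'⟩
  have h2 : ∀ p', Relation.ReflTransGen E p' p → ∀ s, S s p' → Relation.ReflTransGen E' s q := by
    intro p' h
    induction h using Relation.ReflTransGen.head_induction_on with
    | refl => exact fun s hs => .single ((hE' _ _).2 ⟨p, hs, hpq⟩)
    | head h _ ih =>
      intro s hs
      obtain ⟨t, hR, hS'⟩ := (hE _ _).1 h
      exact (ih t hS').head ((hE' _ _).2 ⟨_, hs, hR⟩)
  obtain ⟨p', hp', hR⟩ := h1
  obtain ⟨p'', hS'⟩ := hS s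
  exact h2 p'' (hp p'' (hp'.tail ((hE _ _).2 ⟨_, hR, hS'⟩))) s hS'

theorem reachable_codedShift {Ω A : Type u} {T : Equiv.Perm Ω} {α : Ω → A}
    (p r : (krieger (codedShift T α)).State) :
    (krieger (codedShift T α)).Reachable p r ↔
      Relation.ReflTransGen (fun p r : (krieger (codedShift T α)).State =>
        ∃ a, KriegerStep T α p.1 a r.1) p r := by
  have : (fun p r : (krieger (codedShift T α)).State => ∃ a, KriegerStep T α p.1 a r.1) =
      fun p r => ∃ e, (krieger (codedShift T α)).source e = p ∧
        (krieger (codedShift T α)).target e = r := by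
    ext p r
    simp only [kriegerStep_iff]
    constructor
    · rintro ⟨a, e, h1, h2, -⟩
      exact ⟨e, h1, h2⟩
    · rintro ⟨e, h1, h2⟩
      exact ⟨_, e, h1, h2, rfl⟩
  rw [this]
  rfl

/-- The states of the Krieger automaton that belong to the Fischer automaton. -/
def fischerStates {A : Type u} (X : Set (ℤ → A)) : Set (krieger X).State :=
  {p | ∃ S, (krieger X).IsMinimalComponent S ∧ p ∈ S}

theorem fischer_edge_iff {Ω A : Type u} {T : Equiv.Perm Ω} {α : Ω → A}
    (p r : (fischer (codedShift T α)).State) (a : A) :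
    (∃ e : (fischer (codedShift T α)).Edge, (fischer (codedShift T α)).source e = p ∧
      (fischer (codedShift T α)).target e = r ∧ (fischer (codedShift T α)).label e = a) ↔
      KriegerStep T α p.1.1 a r.1.1 := by
  rw [kriegerStep_iff]
  constructor
  · rintro ⟨e, rfl, rfl, rfl⟩
    exact ⟨e.1, rfl, rfl, rfl⟩
  · rintro ⟨e, h1, h2, rfl⟩
    exact ⟨⟨e, h1 ▸ p.2, h2 ▸ r.2⟩, Subtype.ext h1, Subtype.ext h2, rfl⟩

namespace Bipartite

variable {Ω A A' C D : Type u} {T : Equiv.Perm Ω} {α : Ω → A} {α' : Ω → A'} {c : Ω → C} {d : Ω → D}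

theorem step_iff (h : Bipartite T α α' c d) (p r : (krieger (codedShift T α)).State) :
    (∃ a, KriegerStep T α p.1 a r.1) ↔ ∃ q : (krieger (codedShift T α')).State,
      (∃ x, HalfStep T α α' c p.1 x q.1) ∧ ∃ y, HalfStep T α' (α ∘ T) d q.1 y r.1 := by
  constructor
  · rintro ⟨_, ω, hp, rfl, hr⟩
    exact ⟨kriegerState T α' ω, ⟨c ω, ω, hp, rfl, rfl⟩, d ω, ω, rfl, rfl,
      hr.trans (context_comp T α ω).symm⟩
  · rintro ⟨q, ⟨x, h1⟩, y, h2⟩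
    obtain ⟨ω, hp, -, -, -, hr⟩ := h.exists_of_halfSteps h1 h2
    exact ⟨_, ω, hp, rfl, hr⟩

theorem step_iff' (h : Bipartite T α α' c d) (q s : (krieger (codedShift T α')).State) :
    (∃ a, KriegerStep T α' q.1 a s.1) ↔ ∃ p : (krieger (codedShift T α)).State,
      (∃ y, HalfStep T α' (α ∘ T) d q.1 y p.1) ∧ ∃ x, HalfStep T α α' c p.1 x s.1 := by
  constructor
  · rintro ⟨_, ω, hp, rfl, hr⟩
    exact ⟨kriegerState T α (T ω), ⟨d ω, ω, hp, rfl, (context_comp T α ω).symm⟩, c (T ω), T ω,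
      rfl, rfl, hr⟩
  · rintro ⟨p, ⟨y, h1⟩, x, h2⟩
    obtain ⟨ω, hp, -, -, -, hr⟩ := h.swap.exists_of_halfSteps h1 (halfStep_comp.2 h2)
    exact ⟨_, ω, hp, rfl, hr⟩

/-- Half-steps from `α` to `α'` preserve the states of the Fischer automata. -/
theorem mem_fischerStates (h : Bipartite T α α' c d) {p : (krieger (codedShift T α)).State}
    {q : (krieger (codedShift T α')).State} {x : C} (hp : p ∈ fischerStates (codedShift T α))
    (hpq : HalfStep T α α' c p.1 x q.1) : q ∈ fischerStates (codedShift T α') := by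
  have hp := (Automaton.mem_minimalComponent_iff _ _).1 hp
  refine (Automaton.mem_minimalComponent_iff _ _).2 ?_
  simp only [reachable_codedShift] at hp ⊢
  refine reflTransGen_symm_of_halfStep h.step_iff h.step_iff' (fun q => ?_) hp ⟨x, hpq⟩
  obtain ⟨ω, rfl⟩ := exists_kriegerState T α' q
  exact ⟨kriegerState T α (T ω), d ω, ω, rfl, rfl, (context_comp T α ω).symm⟩

/-- Half-steps from `α'` to `α` preserve the states of the Fischer automata. -/
theorem mem_fischerStates' (h : Bipartite T α α' c d) {p : (krieger (codedShift T α)).State}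
    {q : (krieger (codedShift T α')).State} {y : D} (hq : q ∈ fischerStates (codedShift T α'))
    (hpq : HalfStep T α' (α ∘ T) d q.1 y p.1) : p ∈ fischerStates (codedShift T α) := by
  have hq := (Automaton.mem_minimalComponent_iff _ _).1 hq
  refine (Automaton.mem_minimalComponent_iff _ _).2 ?_
  simp only [reachable_codedShift] at hq ⊢
  refine reflTransGen_symm_of_halfStep h.step_iff' h.step_iff (fun p => ?_) hq ⟨y, hpq⟩
  obtain ⟨ω, rfl⟩ := exists_kriegerState T α p
  exact ⟨kriegerState T α' ω, c ω, ω, rfl, rfl, rfl⟩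

theorem krieger_elementaryEquivalent [Finite A] [Finite A'] [Finite C] [Finite D]
    (h : Bipartite T α α' c d) [Finite (krieger (codedShift T α)).State]
    [Finite (krieger (codedShift T α')).State] :
    SymbolicElementaryEquivalent (krieger (codedShift T α)).adjacencyMatrix
      (krieger (codedShift T α')).adjacencyMatrix := by
  refine h.elementaryEquivalent Subtype.val Subtype.val Subtype.val_injective
    Subtype.val_injective (subsingleton_krieger_edges _) (subsingleton_krieger_edges _)
    (fun p r a => (SoficShift.kriegerStep_iff T α p r a).symm)
    (fun p r a => (SoficShift.kriegerStep_iff T α' p r a).symm) ?_ ?_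
  · rintro p x q ⟨ω, -, -, rfl⟩
    exact ⟨kriegerState T α' ω, rfl⟩
  · rintro q y p ⟨ω, -, -, rfl⟩
    exact ⟨kriegerState T α (T ω), (context_comp T α ω).symm⟩

theorem fischer_elementaryEquivalent [Finite A] [Finite A'] [Finite C] [Finite D]
    (h : Bipartite T α α' c d) [Finite (krieger (codedShift T α)).State]
    [Finite (krieger (codedShift T α')).State] :
    SymbolicElementaryEquivalent (fischer (codedShift T α)).adjacencyMatrix
      (fischer (codedShift T α')).adjacencyMatrix := by
  have : Finite (fischer (codedShift T α)).State :=
    inferInstanceAs (Finite (fischerStates (codedShift T α)))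
  have : Finite (fischer (codedShift T α')).State :=
    inferInstanceAs (Finite (fischerStates (codedShift T α')))
  refine h.elementaryEquivalent (fun p => p.1.1) (fun p => p.1.1)
    (Subtype.val_injective.comp Subtype.val_injective)
    (Subtype.val_injective.comp Subtype.val_injective)
    (subsingleton_restrict_edges _ _ (subsingleton_krieger_edges _))
    (subsingleton_restrict_edges _ _ (subsingleton_krieger_edges _))
    fischer_edge_iff fischer_edge_iff ?_ ?_
  · rintro p x q hq
    obtain ⟨ω, -, -, rfl⟩ := id hq
    exact ⟨⟨kriegerState T α' ω, h.mem_fischerStates p.2 hq⟩, rfl⟩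
  · rintro q y p hp
    obtain ⟨ω, -, -, rfl⟩ := id hp
    rw [context_comp] at hp ⊢
    exact ⟨⟨kriegerState T α (T ω), h.mem_fischerStates' q.2 hp⟩, rfl⟩

/-- By determinism, a state for `α'` is determined by a state for `α` and a half-letter. -/
theorem finite_range_context [Finite C] (h : Bipartite T α α' c d)
    (hf : (Set.range (context T α)).Finite) : (Set.range (context T α')).Finite := by
  let g : Set (ℕ → A) × C → Set (ℕ → A') :=
    Function.extend (fun ω => (context T α ω, c ω)) (context T α') fun _ => ∅
  refine ((hf.prod (Set.finite_univ (α := C))).image g).subset ?_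
  rintro _ ⟨ω, rfl⟩
  refine ⟨(context T α ω, c ω), ⟨⟨ω, rfl⟩, trivial⟩, ?_⟩
  have : Function.FactorsThrough (context T α') fun ω => (context T α ω, c ω) := fun ω ω' he =>
    h.context_eq (Prod.ext_iff.1 he).1 (Prod.ext_iff.1 he).2
  exact this.extend_apply _ _

end Bipartite

/-! ### Chains of codings -/

theorem SymbolicElementaryEquivalent.symm {M N : SquareMatrix.{u}}
    (h : SymbolicElementaryEquivalent M N) : SymbolicElementaryEquivalent N M := by
  obtain ⟨h1, h2, h3, h4, C, D, h5, h6, R, S, h7, h8⟩ := h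
  exact ⟨h2, h1, h4, h3, D, C, h6, h5, S, R, h8, h7⟩

theorem SymbolicStrongShiftEquivalent.symm {M N : SquareMatrix.{u}}
    (h : SymbolicStrongShiftEquivalent M N) : SymbolicStrongShiftEquivalent N M :=
  have : Std.Symm SymbolicElementaryEquivalent.{u} := ⟨fun _ _ h => h.symm⟩
  Std.Symm.symm (r := Relation.ReflTransGen SymbolicElementaryEquivalent) _ _ h

/-- The Krieger automata of the two shift spaces are both finite or both infinite, and if they are
finite, then the matrices of the Krieger automata, and those of the Fischer automata, are symbolic
strong shift equivalent. -/
def Linked {A B : Type u} (X : Set (ℤ → A)) (Y : Set (ℤ → B)) : Prop :=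
  (Finite (krieger X).State ↔ Finite (krieger Y).State) ∧ (Finite (krieger X).State →
    SymbolicStrongShiftEquivalent (krieger X).adjacencyMatrix (krieger Y).adjacencyMatrix ∧
    SymbolicStrongShiftEquivalent (fischer X).adjacencyMatrix (fischer Y).adjacencyMatrix)

theorem Linked.symm {A B : Type u} {X : Set (ℤ → A)} {Y : Set (ℤ → B)} (h : Linked X Y) :
    Linked Y X :=
  ⟨h.1.symm, fun hf => ⟨(h.2 (h.1.2 hf)).1.symm, (h.2 (h.1.2 hf)).2.symm⟩⟩

theorem Linked.trans {A B C : Type u} {X : Set (ℤ → A)} {Y : Set (ℤ → B)} {Z : Set (ℤ → C)}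
    (h : Linked X Y) (h' : Linked Y Z) : Linked X Z :=
  ⟨h.1.trans h'.1, fun hf => ⟨(h.2 hf).1.trans (h'.2 (h.1.1 hf)).1,
    (h.2 hf).2.trans (h'.2 (h.1.1 hf)).2⟩⟩

section

variable {Ω A B C D : Type u} {T : Equiv.Perm Ω}

theorem finite_krieger_iff (α : Ω → A) :
    Finite (krieger (codedShift T α)).State ↔ (Set.range (context T α)).Finite := by
  refine (Set.finite_range_iff (f := fun p : (krieger (codedShift T α)).State => p.1)
    Subtype.val_injective).symm.trans ?_
  congr! 1
  ext p
  constructor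
  · rintro ⟨q, rfl⟩
    obtain ⟨ω, rfl⟩ := exists_kriegerState T α q
    exact ⟨ω, rfl⟩
  · rintro ⟨ω, rfl⟩
    exact ⟨kriegerState T α ω, rfl⟩

theorem Bipartite.linked [Finite A] [Finite B] [Finite C] [Finite D] {α : Ω → A} {β : Ω → B}
    {c : Ω → C} {d : Ω → D} (h : Bipartite T α β c d) :
    Linked (codedShift T α) (codedShift T β) := by
  have hfin : Finite (krieger (codedShift T α)).State ↔
      Finite (krieger (codedShift T β)).State := by
    constructor
    · rw [finite_krieger_iff, finite_krieger_iff]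
      exact h.finite_range_context
    · rw [← codedShift_comp T α, finite_krieger_iff, finite_krieger_iff]
      exact h.swap.finite_range_context
  refine ⟨hfin, fun hf => ?_⟩
  have := hfin.1 hf
  exact ⟨.single h.krieger_elementaryEquivalent, .single h.fischer_elementaryEquivalent⟩

/-- Codings that differ by a bijection of the letters are bipartite, with a trivial half-letter. -/
theorem linked_of_eq_iff [Finite A] [Finite B] {α : Ω → A} {β : Ω → B}
    (h : ∀ ω ω', α ω = α ω' ↔ β ω = β ω') : Linked (codedShift T α) (codedShift T β) := by
  have : Bipartite T α β (fun _ => PUnit.unit.{u + 1}) β := ⟨by simp [h], by simp⟩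
  exact this.linked

/-- Refining a coding `α` by the next value of a coding `γ` that is coarser than `α`. -/
theorem linked_of_refine_right [Finite A] [Finite B] [Finite C] {α : Ω → A} {β : Ω → B} {γ : Ω → C}
    (hγ : ∀ ω ω', α ω = α ω' → γ ω = γ ω')
    (h : ∀ ω ω', β ω = β ω' ↔ α ω = α ω' ∧ γ (T ω) = γ (T ω')) :
    Linked (codedShift T α) (codedShift T β) := by
  have : Bipartite T α β γ α := ⟨fun ω ω' => ⟨fun e => ⟨hγ _ _ e, e⟩, fun e => e.2⟩, h⟩
  exact this.linked

/-- Refining a coding `α` by the previous value of a coding `γ` that is coarser than `α`. -/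
theorem linked_of_refine_left [Finite A] [Finite B] [Finite C] {α : Ω → A} {β : Ω → B} {γ : Ω → C}
    (hγ : ∀ ω ω', α ω = α ω' → γ ω = γ ω')
    (h : ∀ ω ω', β (T ω) = β (T ω') ↔ α (T ω) = α (T ω') ∧ γ ω = γ ω') :
    Linked (codedShift T α) (codedShift T β) := by
  rw [← codedShift_comp T β]
  have : Bipartite T α (β ∘ T) α γ :=
    ⟨fun ω ω' => ⟨fun e => ⟨e, hγ _ _ e⟩, fun e => e.1⟩, fun ω ω' => by
      exact (h ω ω').trans and_comm⟩
  exact this.linked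

/-- The joint coding by the window `I` of the itinerary for `α` and the window `J` of the
itinerary for `β`. -/
def windows (T : Equiv.Perm Ω) (α : Ω → A) (β : Ω → B) (I J : Finset ℤ) (ω : Ω) :
    (I → A) × (J → B) :=
  (fun i => coded T α ω i, fun j => coded T β ω j)

variable {α : Ω → A} {β : Ω → B}

theorem windows_eq_iff {I J : Finset ℤ} {ω ω' : Ω} :
    windows T α β I J ω = windows T α β I J ω' ↔
      (∀ i ∈ I, coded T α ω i = coded T α ω' i) ∧ ∀ j ∈ J, coded T β ω j = coded T β ω' j := by
  simp [windows, Prod.ext_iff, funext_iff]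

theorem forall_Icc_succ_right {P : ℤ → Prop} {a b : ℤ} (h : a ≤ b) :
    (∀ i ∈ Finset.Icc a (b + 1), P i) ↔
      (∀ i ∈ Finset.Icc a b, P i) ∧ ∀ i ∈ Finset.Icc a b, P (i + 1) := by
  simp only [Finset.mem_Icc]
  constructor
  · exact fun H => ⟨fun i hi => H i (by lia), fun i hi => H (i + 1) (by lia)⟩
  · rintro ⟨H1, H2⟩ i hi
    rcases eq_or_lt_of_le hi.2 with rfl | h'
    · exact H2 b (by lia)
    · exact H1 i (by lia)

theorem forall_Icc_pred_left {P : ℤ → Prop} {a b : ℤ} (h : a ≤ b) :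
    (∀ i ∈ Finset.Icc (a - 1) b, P (i + 1)) ↔
      (∀ i ∈ Finset.Icc a b, P (i + 1)) ∧ ∀ i ∈ Finset.Icc a b, P i := by
  simp only [Finset.mem_Icc]
  constructor
  · refine fun H => ⟨fun i hi => H i (by lia), fun i hi => ?_⟩
    simpa using H (i - 1) (by lia)
  · rintro ⟨H1, H2⟩ i hi
    rcases eq_or_lt_of_le hi.1 with rfl | h'
    · simpa using H2 a (by lia)
    · exact H1 i (by lia)

theorem linked_windows_fst_succ [Finite A] [Finite B] {a b : ℤ} (h : a ≤ b) :
    Linked (codedShift T (windows T α β (Finset.Icc a b) ∅))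
      (codedShift T (windows T α β (Finset.Icc a (b + 1)) ∅)) := by
  refine linked_of_refine_right (γ := windows T α β (Finset.Icc a b) ∅) (fun _ _ => id) ?_
  intro ω ω'
  simp only [windows_eq_iff, coded_apply]
  rw [forall_Icc_succ_right h]
  simp

theorem linked_windows_snd_succ [Finite A] [Finite B] {I : Finset ℤ} {a b : ℤ} (h : a ≤ b) :
    Linked (codedShift T (windows T α β I (Finset.Icc a b)))
      (codedShift T (windows T α β I (Finset.Icc a (b + 1)))) := by
  refine linked_of_refine_right (γ := windows T α β ∅ (Finset.Icc a b)) ?_ ?_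
  · intro ω ω'
    simp only [windows_eq_iff]
    exact fun h => ⟨by simp, h.2⟩
  · intro ω ω'
    simp only [windows_eq_iff, coded_apply]
    rw [forall_Icc_succ_right h]
    simp [and_assoc]

theorem linked_windows_snd_pred [Finite A] [Finite B] {I : Finset ℤ} {a b : ℤ} (h : a ≤ b) :
    Linked (codedShift T (windows T α β I (Finset.Icc a b)))
      (codedShift T (windows T α β I (Finset.Icc (a - 1) b))) := by
  refine linked_of_refine_left (γ := windows T α β ∅ (Finset.Icc a b)) ?_ ?_
  · intro ω ω'
    simp only [windows_eq_iff]
    exact fun h => ⟨by simp, h.2⟩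
  · intro ω ω'
    simp only [windows_eq_iff, coded_apply]
    rw [forall_Icc_pred_left (P := fun i => coded T β ω i = coded T β ω' i) h]
    simp [and_assoc]

/-- Two codings each of which is determined by a finite window of the other one are linked: starting
from a window of `α`, adjoin a window of `β` large enough to determine it. -/
theorem linked_of_windows [Finite A] [Finite B] (k : ℕ)
    (hα : ∀ ω ω', (∀ i ∈ Finset.Icc (-k : ℤ) k, coded T α ω i = coded T α ω' i) → β ω = β ω')
    (hβ : ∀ ω ω', (∀ i ∈ Finset.Icc (-k : ℤ) k, coded T β ω i = coded T β ω' i) → α ω = α ω') :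
    Linked (codedShift T α) (codedShift T β) := by
  have shift_window : ∀ {L : Type u} (γ : Ω → L) (n i : ℤ) (ω : Ω),
      coded T γ ((T ^ n) ω) i = coded T γ ω (i + n) := fun γ n i ω => by
    simp [coded, zpow_add]
  have hα' : ∀ ω ω' (n : ℤ), (∀ i ∈ Finset.Icc (n - k) (n + k), coded T α ω i = coded T α ω' i) →
      coded T β ω n = coded T β ω' n := fun ω ω' n h => by
    refine hα _ _ fun i hi => ?_
    rw [shift_window, shift_window]
    rw [Finset.mem_Icc] at hi
    exact h _ (Finset.mem_Icc.2 (by lia))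
  have hβ' : ∀ ω ω' (n : ℤ), (∀ i ∈ Finset.Icc (n - k) (n + k), coded T β ω i = coded T β ω' i) →
      coded T α ω n = coded T α ω' n := fun ω ω' n h => by
    refine hβ _ _ fun i hi => ?_
    rw [shift_window, shift_window]
    rw [Finset.mem_Icc] at hi
    exact h _ (Finset.mem_Icc.2 (by lia))
  -- the window of `α` grows from `[0, 0]` to `[0, 2k]`, which determines `β` at time `k`
  have h0 : Linked (codedShift T α) (codedShift T (windows T α β (Finset.Icc 0 0) ∅)) :=
    linked_of_eq_iff fun ω ω' => by simp [windows_eq_iff, coded]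
  have h1 : ∀ n : ℕ, Linked (codedShift T α)
      (codedShift T (windows T α β (Finset.Icc 0 n) ∅)) := fun n => by
    induction n with
    | zero => exact h0
    | succ n ih => exact ih.trans (by exact_mod_cast linked_windows_fst_succ (by lia))
  have h2 : Linked (codedShift T α)
      (codedShift T (windows T α β (Finset.Icc 0 (2 * k : ℕ)) (Finset.Icc k (k + (0 : ℕ))))) := by
    refine (h1 (2 * k)).trans (linked_of_eq_iff fun ω ω' => ?_)
    simp only [windows_eq_iff]
    refine and_congr_right fun h => ?_
    simp only [Nat.cast_zero, add_zero, Finset.Icc_self, Finset.mem_singleton, forall_eq]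
    refine ⟨fun _ => hα' ω ω' k fun i hi => h i ?_, by simp⟩
    rw [Finset.mem_Icc] at hi ⊢
    push_cast
    lia
  -- the window of `β` grows from `[k, k]` to `[-k, 3k]`, which determines `α` on `[0, 2k]`
  have h3 : ∀ n : ℕ, Linked (codedShift T α) (codedShift T
      (windows T α β (Finset.Icc 0 (2 * k : ℕ)) (Finset.Icc k (k + n)))) := fun n => by
    induction n with
    | zero => exact h2
    | succ n ih =>
      have := ih.trans (linked_windows_snd_succ (by lia))
      rw [add_assoc] at this
      exact_mod_cast this
  have h4 : ∀ m n : ℕ, Linked (codedShift T α) (codedShift T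
      (windows T α β (Finset.Icc 0 (2 * k : ℕ)) (Finset.Icc (k - m) (k + n)))) := fun m n => by
    induction m with
    | zero =>
      rw [show (k - (0 : ℕ) : ℤ) = k by simp]
      exact h3 n
    | succ m ih =>
      have := ih.trans (linked_windows_snd_pred (by lia))
      rwa [sub_sub, ← Nat.cast_succ] at this
  have h5 : Linked (codedShift T α)
      (codedShift T (windows T α β ∅ (Finset.Icc (-k : ℤ) (3 * k)))) := by
    refine (h4 (2 * k) (2 * k)).trans (linked_of_eq_iff fun ω ω' => ?_)
    have e1 : (k - (2 * k : ℕ) : ℤ) = -k := by push_cast; ring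
    have e2 : (k + (2 * k : ℕ) : ℤ) = 3 * k := by push_cast; ring
    simp only [windows_eq_iff, e1, e2]
    refine and_congr_left fun h => ⟨fun _ => by simp, fun _ i hi => hβ' ω ω' i fun j hj => h j ?_⟩
    rw [Finset.mem_Icc] at hi hj ⊢
    push_cast at hi
    lia
  -- conversely, `β` delayed by `k` has the same shift as `β`, and its window grows to `[-k, 3k]`
  have h6 : Linked (codedShift T β)
      (codedShift T (windows T α β ∅ (Finset.Icc (-k : ℤ) (-k + (0 : ℕ))))) := by
    have hs : ∀ n : ℕ, codedShift T (fun ω => β ((T ^ (-n : ℤ)) ω)) = codedShift T β := fun n => by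
      induction n with
      | zero => simp
      | succ n ih =>
        rw [← ih, ← codedShift_comp T (fun ω => β ((T ^ (-(n + 1 : ℕ) : ℤ)) ω))]
        congr 1
        ext ω
        simp only [Function.comp_apply, ← Equiv.Perm.mul_apply, ← zpow_add_one]
        congr 3
        push_cast
        ring
    rw [← hs k]
    exact linked_of_eq_iff fun ω ω' => by simp [windows_eq_iff, coded]
  have h7 : ∀ n : ℕ, Linked (codedShift T β)
      (codedShift T (windows T α β ∅ (Finset.Icc (-k : ℤ) (-k + n)))) := fun n => by
    induction n with
    | zero => exact h6
    | succ n ih =>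
      have := ih.trans (linked_windows_snd_succ (by lia))
      rw [add_assoc] at this
      exact_mod_cast this
  have h8 := h7 (4 * k)
  rw [show (-k + (4 * k : ℕ) : ℤ) = 3 * k by push_cast; ring] at h8
  exact h5.trans h8.symm

end

/-! ### Words and sofic shifts -/

/-- The word `x i ⋯ x (i + n - 1)`. -/
def word {A : Type u} (x : ℤ → A) (i : ℤ) (n : ℕ) : List A :=
  (List.range n).map fun k : ℕ => x (i + k)

section Word

variable {A : Type u}

@[simp]
theorem length_word (x : ℤ → A) (i : ℤ) (n : ℕ) : (word x i n).length = n := by simp [word]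

theorem word_add (x : ℤ → A) (i : ℤ) (m n : ℕ) :
    word x i (m + n) = word x i m ++ word x (i + m) n := by
  simp [word, List.range_add, add_assoc]

theorem word_eq_word_iff {x x' : ℤ → A} {i i' : ℤ} {n : ℕ} :
    word x i n = word x' i' n ↔ ∀ k < n, x (i + k) = x' (i' + k) := by
  simp [word]

theorem isFactor_iff {w : List A} {x : ℤ → A} : IsFactor w x ↔ ∃ i n, w = word x i n := by
  constructor
  · rintro ⟨i, h⟩
    refine ⟨i, w.length, List.ext_getElem (by simp) fun k hk _ => ?_⟩
    simp [word, h k hk]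
  · rintro ⟨i, n, rfl⟩
    exact ⟨i, fun k hk => by simp [word]⟩

theorem mem_avoiding_iff {W : Language A} {x : ℤ → A} :
    x ∈ avoiding W ↔ ∀ i n, word x i n ∉ W := by
  constructor
  · exact fun h i n hw => h _ hw (isFactor_iff.2 ⟨i, n, rfl⟩)
  · rintro h w hw hf
    obtain ⟨i, n, rfl⟩ := isFactor_iff.1 hf
    exact h i n hw

/-- A sofic shift contains every word all of whose factors are blocks of the shift. -/
theorem IsSofic.mem_of_words {X : Set (ℤ → A)} (hX : IsSofic X) {x : ℤ → A}
    (h : ∀ i n, ∃ x' ∈ X, ∃ j, word x i n = word x' j n) : x ∈ X := by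
  obtain ⟨W, -, rfl⟩ := hX
  refine mem_avoiding_iff.2 fun i n => ?_
  obtain ⟨x', hx', j, hj⟩ := h i n
  rw [hj]
  exact mem_avoiding_iff.1 hx' j n

theorem IsSofic.translate_mem {X : Set (ℤ → A)} (hX : IsSofic X) {x : ℤ → A} (hx : x ∈ X)
    (m : ℤ) : (fun n => x (n + m)) ∈ X := by
  refine hX.mem_of_words fun i n => ⟨x, hx, i + m, word_eq_word_iff.2 fun k _ => ?_⟩
  exact congrArg x (add_right_comm _ _ _)

/-- The shift map of a sofic shift. -/
def IsSofic.shiftPerm {X : Set (ℤ → A)} (hX : IsSofic X) : Equiv.Perm X where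
  toFun x := ⟨fun n => x.1 (n + 1), hX.translate_mem x.2 1⟩
  invFun x := ⟨fun n => x.1 (n + -1), hX.translate_mem x.2 (-1)⟩
  left_inv x := by ext n; simp
  right_inv x := by ext n; simp

theorem coded_eq {Ω : Type u} (T : Equiv.Perm Ω) (v : Ω → ℤ → A)
    (hv : ∀ ω m, v (T ω) m = v ω (m + 1)) : coded T (fun ω => v ω 0) = v := by
  ext ω n
  induction n using Int.induction_on generalizing ω with
  | zero => simp [coded]
  | succ n ih => rw [← hv, ← ih, coded_apply]
  | pred n ih =>
    obtain ⟨ω, rfl⟩ := T.surjective ω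
    rw [coded_apply, hv, sub_add_cancel, ih]

theorem IsSofic.coded_shiftPerm {X : Set (ℤ → A)} (hX : IsSofic X) :
    coded hX.shiftPerm (fun x : X => x.1 0) = Subtype.val :=
  coded_eq hX.shiftPerm Subtype.val fun _ _ => rfl

theorem IsSofic.codedShift_shiftPerm {X : Set (ℤ → A)} (hX : IsSofic X) :
    codedShift hX.shiftPerm (fun x : X => x.1 0) = X := by
  rw [codedShift, hX.coded_shiftPerm, Subtype.range_coe]

theorem IsSofic.isClosed [TopologicalSpace A] [DiscreteTopology A] {X : Set (ℤ → A)}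
    (hX : IsSofic X) : IsClosed X := by
  refine isClosed_iff_frequently.2 fun x hx => hX.mem_of_words fun i n => ?_
  have hopen : ∀ᶠ x' in nhds x, x' ∈ SymbolicDynamics.FullShift.cylinder
      ((Finset.range n).image fun k : ℕ => i + k) x :=
    (SymbolicDynamics.FullShift.isOpen_cylinder _ x).mem_nhds fun _ _ => rfl
  obtain ⟨x', hx', hc⟩ := (hx.and_eventually hopen).exists
  exact ⟨x', hx', i, word_eq_word_iff.2 fun k hk => (hc (i + k) (by simpa using hk)).symm⟩

/-- The word formed by the last `m` letters of a left infinite word. -/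
def lastWord (y : ℕ → A) (m : ℕ) : List A := (List.range m).map fun k : ℕ => y (m - 1 - k)

theorem join_natCast (y z : ℕ → A) (n : ℕ) : join y z n = z n := rfl

theorem join_of_neg (y z z' : ℕ → A) {i : ℤ} (hi : i < 0) : join y z i = join y z' i := by
  obtain ⟨n, rfl⟩ := Int.eq_negSucc_of_lt_zero hi
  rfl

theorem join_of_nonneg (y y' z : ℕ → A) {i : ℤ} (hi : 0 ≤ i) : join y z i = join y' z i := by
  obtain ⟨n, rfl⟩ := Int.eq_ofNat_of_zero_le hi
  rfl

theorem word_join_neg (y z : ℕ → A) (m : ℕ) : word (join y z) (-m) m = lastWord y m := by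
  refine List.map_congr_left fun k hk => ?_
  have : (-m + k : ℤ) = Int.negSucc (m - 1 - k) := by
    rw [List.mem_range] at hk
    lia
  rw [this]
  rfl

theorem word_join (y z : ℕ → A) (m l : ℕ) :
    word (join y z) (-m) (m + l) = lastWord y m ++ word (join y z) 0 l := by
  rw [word_add, word_join_neg, neg_add_cancel]

/-- The set of right contexts of a left infinite word, when it is not empty, is determined by the
set of states to which the suffixes of the word lead in a finite automaton that recognizes the
forbidden words. -/
theorem IsSofic.finite_krieger {X : Set (ℤ → A)} (hX : IsSofic X) : Finite (krieger X).State := by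
  obtain ⟨W, ⟨σ, _, M, rfl⟩, rfl⟩ := hX
  choose y hy using fun p : (krieger (avoiding M.accepts)).State => p.2.2
  let S : (ℕ → A) → Set σ := fun y => Set.range fun m => M.eval (lastWord y m)
  have key : ∀ y y₀ z z₀ : ℕ → A, S y₀ ⊆ S y → join y z ∈ avoiding M.accepts →
      join y₀ z₀ ∈ avoiding M.accepts → join y₀ z ∈ avoiding M.accepts := by
    intro y y₀ z z₀ hS h h₀
    rw [mem_avoiding_iff] at h h₀ ⊢
    intro i n hw
    -- A forbidden factor lies in `z`, or in `y₀`, or across the origin. In the last case its left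
    -- part can be replaced by a suffix of `y` that leads to the same state.
    rcases le_or_gt 0 i with hi | hi
    · refine h i n ?_
      rwa [word_eq_word_iff.2 fun k _ => join_of_nonneg y y₀ z (i := i + k) (by lia)]
    · obtain ⟨m, rfl⟩ : ∃ m : ℕ, i = -m := ⟨i.natAbs, by lia⟩
      rcases le_total n m with hn | hn
      · refine h₀ (-m) n ?_
        rwa [word_eq_word_iff.2 fun k hk => join_of_neg y₀ z₀ z (i := -m + k) (by lia)]
      · obtain ⟨l, rfl⟩ := Nat.exists_eq_add_of_le hn
        obtain ⟨m', hm'⟩ := hS ⟨m, rfl⟩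
        refine h (-m') (m' + l) ?_
        rw [word_join, DFA.mem_accepts] at hw ⊢
        simp only [DFA.eval, DFA.evalFrom_of_append] at hw hm' ⊢
        rw [hm', word_eq_word_iff.2 fun k _ => join_of_nonneg y y₀ z (i := 0 + k) (by lia)]
        exact hw
  refine Finite.of_injective (β := Set σ) (fun p => S (y p)) fun p q hpq => Subtype.ext ?_
  obtain ⟨z₁, hz₁⟩ := p.2.1
  obtain ⟨z₂, hz₂⟩ := q.2.1
  rw [hy] at hz₁ hz₂
  rw [hy p, hy q]
  ext z
  exact ⟨fun hz => key _ _ z z₂ (le_of_eq hpq.symm) hz hz₂,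
    fun hz => key _ _ z z₁ (le_of_eq hpq) hz hz₁⟩

end Word

/-! ### Conjugate sofic shifts are linked -/

/-- If `f` determines `g`, then by compactness a finite window of `f` determines `g`. -/
theorem exists_window {K : Type*} {A B : Type u} [TopologicalSpace K] [CompactSpace K]
    [TopologicalSpace A] [DiscreteTopology A] [TopologicalSpace B] [DiscreteTopology B]
    {f : K → ℤ → A} {g : K → B} (hf : Continuous f) (hg : Continuous g)
    (h : ∀ x x', f x = f x' → g x = g x') :
    ∃ k : ℕ, ∀ x x', (∀ i ∈ Finset.Icc (-k : ℤ) k, f x i = f x' i) → g x = g x' := by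
  by_contra! hne
  let t : ℕ → Set (K × K) := fun k =>
    {p | (∀ i ∈ Finset.Icc (-k : ℤ) k, f p.1 i = f p.2 i) ∧ g p.1 ≠ g p.2}
  have hclosed : ∀ k, IsClosed (t k) := by
    intro k
    change IsClosed ({p | ∀ i ∈ Finset.Icc (-k : ℤ) k, f p.1 i = f p.2 i} ∩
      {p : K × K | g p.1 ≠ g p.2})
    refine IsClosed.inter ?_ ?_
    · simp only [Set.ofPred_forall]
      refine isClosed_iInter fun i => isClosed_iInter fun _ => ?_
      exact isClosed_eq (by fun_prop) (by fun_prop)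
    · exact (isClosed_discrete {q : B × B | q.1 ≠ q.2}).preimage
        ((hg.comp continuous_fst).prodMk (hg.comp continuous_snd))
  obtain ⟨p, hp⟩ := IsCompact.nonempty_iInter_of_sequence_nonempty_isCompact_isClosed t
    (fun k p hp => ⟨fun i hi => hp.1 i (by rw [Finset.mem_Icc] at hi ⊢; push_cast; lia), hp.2⟩)
    (fun k => by obtain ⟨x, x', h1, h2⟩ := hne k; exact ⟨(x, x'), h1, h2⟩)
    (hclosed 0).isCompact hclosed
  rw [Set.mem_iInter] at hp
  refine (hp 0).2 (h _ _ (funext fun i => (hp i.natAbs).1 i ?_))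
  rw [Finset.mem_Icc]
  lia

theorem IsSofic.linked_of_areConjugate {A A' : Type u} [Finite A] [Finite A'] {X : Set (ℤ → A)}
    {X' : Set (ℤ → A')} (hX : IsSofic X) (h : AreConjugate X X') : Linked X X' := by
  let _ : TopologicalSpace A := ⊥
  let _ : TopologicalSpace A' := ⊥
  have : DiscreteTopology A := ⟨rfl⟩
  have : DiscreteTopology A' := ⟨rfl⟩
  obtain ⟨φ, hc, hb, hs⟩ := h
  have hφ : ∀ x m, (φ (hX.shiftPerm x)).1 m = (φ x).1 (m + 1) := fun x m => by
    rw [hs x (hX.shiftPerm x) (funext fun n => congrArg x.1 (add_comm n 1))]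
    exact congrArg (φ x).1 (add_comm 1 m)
  have hβ := coded_eq hX.shiftPerm (fun x => (φ x).1) hφ
  have hX' : codedShift hX.shiftPerm (fun x => (φ x).1 0) = X' := by
    rw [codedShift, hβ]
    exact (Set.range_comp Subtype.val φ).trans (by simp [hb.2.range_eq])
  have : CompactSpace X := isCompact_iff_compactSpace.1 hX.isClosed.isCompact
  have hc' : Continuous fun x => (φ x).1 := continuous_subtype_val.comp hc
  obtain ⟨k₁, h₁⟩ := exists_window (f := fun x : X => x.1) (g := fun x => (φ x).1 0)
    continuous_subtype_val ((continuous_apply 0).comp hc')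
    fun x x' h => by rw [Subtype.ext h]
  obtain ⟨k₂, h₂⟩ := exists_window (f := fun x : X => (φ x).1) (g := fun x => x.1 0)
    hc' ((continuous_apply 0).comp continuous_subtype_val)
    fun x x' h => by rw [hb.1 (Subtype.ext h)]
  have key := linked_of_windows (T := hX.shiftPerm) (α := fun x : X => x.1 0)
    (β := fun x => (φ x).1 0) (max k₁ k₂) ?_ ?_
  · rwa [hX.codedShift_shiftPerm, hX'] at key
  · rw [hX.coded_shiftPerm]
    refine fun x x' h => h₁ x x' fun i hi => h i ?_
    rw [Finset.mem_Icc] at hi ⊢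
    lia
  · rw [hβ]
    refine fun x x' h => h₂ x x' fun i hi => h i ?_
    rw [Finset.mem_Icc] at hi ⊢
    lia

/-! ### The shifts recognized by the Krieger and Fischer automata -/

section Recognized

variable {Ω A : Type u} {T : Equiv.Perm Ω} {α : Ω → A}

theorem KriegerStep.exists_cons {p r : Set (ℕ → A)} {a : A} (h : KriegerStep T α p a r)
    {z : ℕ → A} (hz : z ∈ r) : ∃ z' ∈ p, z' 0 = a ∧ ∀ k, z' (k + 1) = z k := by
  obtain ⟨ω, rfl, rfl, rfl⟩ := h
  obtain ⟨ω', hp, rfl⟩ := (mem_context T α).1 hz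
  obtain ⟨ω', rfl⟩ := T.surjective ω'
  rw [past_apply, past_apply] at hp
  refine ⟨future T α ω', (mem_context T α).2 ⟨ω', funext fun n => congrFun hp (n + 1), rfl⟩, ?_, ?_⟩
  · rw [future_zero]
    exact congrFun hp 0
  · intro k
    simp [future, coded_apply]

/-- The labels of the paths of the Krieger automaton are blocks: each state is nonempty, and
prepending the label of an edge maps its target into its source. -/
theorem exists_mem_of_path {p : ℤ → (krieger (codedShift T α)).State} {x : ℤ → A}
    (h : ∀ i, KriegerStep T α (p i).1 (x i) (p (i + 1)).1) (n : ℕ) (i : ℤ) :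
    ∃ z ∈ (p i).1, ∀ k < n, z k = x (i + k) := by
  induction n generalizing i with
  | zero =>
    obtain ⟨z, hz⟩ := (p i).2.1
    exact ⟨z, hz, by simp⟩
  | succ n ih =>
    obtain ⟨z, hz, hk⟩ := ih (i + 1)
    obtain ⟨z', hz', h0, hs⟩ := (h i).exists_cons hz
    refine ⟨z', hz', fun k hk' => ?_⟩
    cases k with
    | zero => simpa using h0
    | succ k =>
      rw [hs, hk k (by lia)]
      congr 1
      push_cast
      ring

theorem mem_codedShift_of_path (hX : IsSofic (codedShift T α))
    {p : ℤ → (krieger (codedShift T α)).State} {x : ℤ → A}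
    (h : ∀ i, KriegerStep T α (p i).1 (x i) (p (i + 1)).1) : x ∈ codedShift T α := by
  refine hX.mem_of_words fun i n => ?_
  obtain ⟨z, hz, hk⟩ := exists_mem_of_path h n i
  obtain ⟨y, hy⟩ := (p i).2.2
  rw [hy] at hz
  refine ⟨_, hz, 0, word_eq_word_iff.2 fun k hk' => ?_⟩
  rw [zero_add, join_natCast, hk k hk']

theorem labelShift_krieger_codedShift (hX : IsSofic (codedShift T α)) :
    (krieger (codedShift T α)).labelShift = codedShift T α := by
  ext x
  constructor
  · rintro ⟨e, he, rfl⟩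
    refine mem_codedShift_of_path hX (p := fun i => (krieger _).source (e i)) fun i => ?_
    rw [kriegerStep_iff]
    exact ⟨e i, rfl, he i, rfl⟩
  · rintro ⟨ω, rfl⟩
    have : ∀ n : ℤ, KriegerStep T α (kriegerState T α ((T ^ n) ω)).1 (coded T α ω n)
        (kriegerState T α ((T ^ (n + 1)) ω)).1 := fun n =>
      ⟨(T ^ n) ω, rfl, rfl, by rw [add_comm, zpow_one_add]; rfl⟩
    simp only [kriegerStep_iff] at this
    choose e h1 h2 h3 using this
    exact ⟨e, fun n => (h2 n).trans (h1 (n + 1)).symm, funext fun n => (h3 n).symm⟩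

theorem kriegerState_eq_of_past_eq {ω ω' : Ω} (h : past T α ω = past T α ω') :
    kriegerState T α ω = kriegerState T α ω' :=
  Subtype.ext (by simp only [kriegerState, context, h])

theorem reachable_pow (ω : Ω) (n : ℕ) :
    (krieger (codedShift T α)).Reachable (kriegerState T α ω) (kriegerState T α ((T ^ n) ω)) := by
  rw [reachable_codedShift]
  induction n with
  | zero => exact .refl
  | succ n ih =>
    refine ih.tail ⟨_, (T ^ n) ω, rfl, rfl, ?_⟩
    rw [pow_succ']
    rfl

theorem mem_fischerStates_of_reachable {X : Set (ℤ → A)} {p q : (krieger X).State}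
    (hp : p ∈ fischerStates X) (h : (krieger X).Reachable p q) : q ∈ fischerStates X := by
  have hp := (Automaton.mem_minimalComponent_iff _ _).1 hp
  refine (Automaton.mem_minimalComponent_iff _ _).2 fun r hr => ?_
  exact (hp r (h.trans hr)).trans h

/-- A state from which the fewest states are reachable lies in a minimal component. -/
theorem fischerStates_nonempty {X : Set (ℤ → A)} [Finite (krieger X).State]
    [Nonempty (krieger X).State] : (fischerStates X).Nonempty := by
  obtain ⟨p, hp⟩ := Finite.exists_min fun p => {q | (krieger X).Reachable p q}.ncard
  refine ⟨p, (Automaton.mem_minimalComponent_iff _ _).2 fun q hq => ?_⟩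
  have hsub : {r | (krieger X).Reachable q r} ⊆ {r | (krieger X).Reachable p r} :=
    fun r hr => hq.trans hr
  have := Set.eq_of_subset_of_ncard_le hsub (hp q) (Set.toFinite _)
  exact this.symm.subset Relation.ReflTransGen.refl

theorem word_coded_congr {ω ω' : Ω} (h : past T α ω = past T α ω') {i : ℤ} {n : ℕ}
    (hn : i + n ≤ 0) : word (coded T α ω) i n = word (coded T α ω') i n := by
  refine word_eq_word_iff.2 fun k hk => ?_
  obtain ⟨m, hm⟩ := Int.eq_negSucc_of_lt_zero (a := i + k) (by lia)
  rw [hm]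
  exact congrFun h m

/-- The right contexts of a left infinite word over a sofic shift are those of a long enough finite
suffix. Otherwise there would be futures of points sharing longer and longer suffixes of the past
of `ω` that are not contexts of `ω`; as there are finitely many Krieger states, one of these futures
is compatible with arbitrarily long suffixes, hence with the whole past. -/
theorem exists_suffix_determining_context (hX : IsSofic (codedShift T α)) (ω : Ω) :
    ∃ N : ℕ, ∀ ω', word (coded T α ω') (-N) N = word (coded T α ω) (-N) N →
      future T α ω' ∈ context T α ω := by
  by_contra! hne
  choose ω' hw hf using hne
  have := hX.finite_krieger
  obtain ⟨p, hp⟩ := Finite.exists_infinite_fiber fun n => kriegerState T α (ω' n)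
  have hinf : (((fun n => kriegerState T α (ω' n)) ⁻¹' {p}) : Set ℕ).Infinite :=
    Set.infinite_coe_iff.1 hp
  obtain ⟨n₀, hn₀⟩ := hinf.nonempty
  refine hf n₀ ?_
  change join _ _ ∈ codedShift T α
  refine hX.mem_of_words fun i n => ?_
  obtain ⟨m, hm, him⟩ := hinf.exists_gt i.natAbs
  have hctx : context T α (ω' m) = context T α (ω' n₀) :=
    congrArg Subtype.val ((show _ = p from hm).trans (show _ = p from hn₀).symm)
  obtain ⟨ω₁, hp₁, hf₁⟩ := exists_of_context_eq T α hctx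
  refine ⟨coded T α ω₁, ⟨ω₁, rfl⟩, i, word_eq_word_iff.2 fun k hk => ?_⟩
  rcases lt_or_ge (i + k : ℤ) 0 with hneg | hpos
  · have h1 := (word_coded_congr hp₁ (i := -m) (n := m) (by simp)).trans (hw m)
    rw [word_eq_word_iff] at h1
    have h2 := h1 (m + (i + k)).toNat (by lia)
    rw [show (-m + ((m + (i + k)).toNat : ℕ) : ℤ) = i + k by lia] at h2
    rw [h2]
    obtain ⟨j, hj⟩ := Int.eq_negSucc_of_lt_zero hneg
    rw [hj]
    rfl
  · obtain ⟨j, hj⟩ := Int.eq_ofNat_of_zero_le hpos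
    rw [hj]
    exact (congrFun hf₁ j).symm

/-- In an irreducible sofic shift, every block can be read inside the Fischer automaton. -/
theorem exists_fischer_path (hX : IsSofic (codedShift T α)) (hirr : IsIrreducible (codedShift T α))
    (ω : Ω) (i : ℤ) (n : ℕ) : ∃ ω', word (coded T α ω') 0 n = word (coded T α ω) i n ∧
      ∀ k : ℕ, kriegerState T α ((T ^ k) ω') ∈ fischerStates (codedShift T α) := by
  have := hX.finite_krieger
  have : Nonempty (krieger (codedShift T α)).State := ⟨kriegerState T α ω⟩
  obtain ⟨p, hp⟩ := fischerStates_nonempty (X := codedShift T α)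
  obtain ⟨ω₀, rfl⟩ := exists_kriegerState T α p
  obtain ⟨N, hN⟩ := exists_suffix_determining_context hX ω₀
  obtain ⟨w, -, x, ⟨ω₁, rfl⟩, hx⟩ := hirr (word (coded T α ω₀) (-N) N)
    ⟨_, ⟨ω₀, rfl⟩, isFactor_iff.2 ⟨_, _, rfl⟩⟩ (word (coded T α ω) i n)
    ⟨_, ⟨ω, rfl⟩, isFactor_iff.2 ⟨_, _, rfl⟩⟩
  obtain ⟨j, l, hj⟩ := isFactor_iff.1 hx
  have hl : l = N + w.length + n := by
    have := congrArg List.length hj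
    simp only [List.length_append, length_word] at this
    exact this.symm
  subst hl
  rw [word_add, word_add] at hj
  obtain ⟨hj, hv⟩ := List.append_inj' hj (by simp)
  obtain ⟨hu, -⟩ := List.append_inj hj (by simp)
  have hshift : ∀ (m : ℤ) (ω : Ω) (i : ℤ) (n : ℕ),
      word (coded T α ((T ^ m) ω)) i n = word (coded T α ω) (i + m) n := fun m ω i n => by
    refine word_eq_word_iff.2 fun k _ => ?_
    simp only [coded, ← Equiv.Perm.mul_apply, ← zpow_add]
    congr 3
    ring
  have hctx := hN ((T ^ (j + N)) ω₁) (by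
    rw [hshift, hu]
    congr 1
    ring)
  obtain ⟨ω₂, hp₂, hf₂⟩ := (mem_context T α).1 hctx
  refine ⟨(T ^ w.length) ω₂, ?_, fun k => ?_⟩
  · rw [hv, ← zpow_natCast, hshift]
    refine word_eq_word_iff.2 fun k _ => ?_
    have h1 : coded T α ω₂ (w.length + k : ℕ) =
        coded T α ((T ^ (j + N)) ω₁) (w.length + k : ℕ) := congrFun hf₂ _
    have h2 := word_eq_word_iff.1 (hshift (j + N) ω₁ ((w.length + k : ℕ) : ℤ) 1) 0 one_pos
    simp only [Nat.cast_zero, add_zero] at h2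
    rw [h2] at h1
    push_cast at h1 ⊢
    convert h1 using 2 <;> ring
  · refine mem_fischerStates_of_reachable hp ?_
    rw [← kriegerState_eq_of_past_eq hp₂, ← Equiv.Perm.mul_apply, ← pow_add]
    exact reachable_pow _ _

theorem labelShift_fischer_codedShift [Finite A] (hX : IsSofic (codedShift T α))
    (hirr : IsIrreducible (codedShift T α)) :
    (fischer (codedShift T α)).labelShift = codedShift T α := by
  set ℱ := fischer (codedShift T α) with hℱ
  ext x
  constructor
  · rintro ⟨e, he, rfl⟩
    refine mem_codedShift_of_path hX (p := fun i => (ℱ.source (e i)).1) fun i => ?_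
    rw [← fischer_edge_iff]
    exact ⟨e i, rfl, he i, rfl⟩
  · rintro ⟨ω, rfl⟩
    have := hX.finite_krieger
    have : Finite ℱ.State := inferInstanceAs (Finite (fischerStates (codedShift T α)))
    have : Finite ℱ.Edge := by
      refine Finite.of_injective (fun e => (ℱ.source e, ℱ.target e, ℱ.label e)) fun e e' h => ?_
      simp only [Prod.mk.injEq] at h
      have := (subsingleton_restrict_edges _ _ (subsingleton_krieger_edges _)
        (ℱ.source e) (ℱ.target e) (ℱ.label e)).elim ⟨e, rfl, rfl, rfl⟩
        ⟨e', h.1.symm, h.2.1.symm, h.2.2.symm⟩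
      exact congrArg Subtype.val this
    let _ : TopologicalSpace ℱ.Edge := ⊥
    have : DiscreteTopology ℱ.Edge := ⟨rfl⟩
    -- finite paths labeled by the central factors of the word exist, and compactness yields a
    -- biinfinite one
    let t : ℕ → Set (ℤ → ℱ.Edge) := fun n => {e | ∀ i ∈ Finset.Ico (-n : ℤ) n,
      ℱ.label (e i) = coded T α ω i ∧ ℱ.target (e i) = ℱ.source (e (i + 1))}
    have hclosed : ∀ n, IsClosed (t n) := by
      intro n
      simp only [t, Set.ofPred_forall]
      refine isClosed_iInter fun i => isClosed_iInter fun _ => ?_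
      have hpair : Continuous fun e : ℤ → ℱ.Edge => (e i, e (i + 1)) := by fun_prop
      exact (isClosed_discrete {q : ℱ.Edge × ℱ.Edge | ℱ.label q.1 = coded T α ω i ∧
        ℱ.target q.1 = ℱ.source q.2}).preimage hpair
    have hne : ∀ n, (t n).Nonempty := by
      intro n
      obtain ⟨ω', hw, hk⟩ := exists_fischer_path hX hirr ω (-n) (2 * n)
      have hedge : ∀ k : ℕ, ∃ e : ℱ.Edge, ℱ.source e = ⟨_, hk k⟩ ∧ ℱ.target e = ⟨_, hk (k + 1)⟩ ∧
          ℱ.label e = coded T α ω' k := fun k =>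
        (fischer_edge_iff _ _ _).2 ⟨(T ^ k) ω', rfl, by simp [coded],
          congrArg (fun S : Equiv.Perm Ω => context T α (S ω')) (pow_succ' T k)⟩
      choose e h1 h2 h3 using hedge
      -- the edges before position `-n` are irrelevant, and `toNat` makes them constant
      refine ⟨fun i => e (i + n).toNat, fun i hi => ?_⟩
      rw [Finset.mem_Ico] at hi
      constructor
      · have := word_eq_word_iff.1 hw (i + n).toNat (by lia)
        rw [zero_add, show (-n + ((i + n).toNat : ℕ) : ℤ) = i by lia] at this
        rw [h3, this]
      · change _ = ℱ.source (e (i + 1 + n).toNat)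
        rw [show (i + 1 + n).toNat = (i + n).toNat + 1 by lia]
        exact (h2 _).trans (h1 _).symm
    obtain ⟨e, he⟩ := IsCompact.nonempty_iInter_of_sequence_nonempty_isCompact_isClosed t
      (fun n e he i hi => he i (by rw [Finset.mem_Ico] at hi ⊢; push_cast; lia)) hne
      (hclosed 0).isCompact hclosed
    rw [Set.mem_iInter] at he
    have he' : ∀ i : ℤ, _ := fun i =>
      he (i.natAbs + 1) i (by rw [Finset.mem_Ico]; lia)
    exact ⟨e, fun i => (he' i).2, funext fun i => (he' i).1.symm⟩

end Recognized

theorem IsSofic.labelShift_krieger {A : Type u} {X : Set (ℤ → A)} (hX : IsSofic X) :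
    (krieger X).labelShift = X := by
  have := labelShift_krieger_codedShift (T := hX.shiftPerm) (α := fun x : X => x.1 0)
  rw [hX.codedShift_shiftPerm] at this
  exact this hX

theorem IsSofic.labelShift_fischer {A : Type u} [Finite A] {X : Set (ℤ → A)} (hX : IsSofic X)
    (hirr : IsIrreducible X) : (fischer X).labelShift = X := by
  have := labelShift_fischer_codedShift (T := hX.shiftPerm) (α := fun x : X => x.1 0)
  rw [hX.codedShift_shiftPerm] at this
  exact this hX hirr

theorem SymbolicConjugate.areConjugate {A B : Type u} {𝒜 : Automaton A} {ℬ : Automaton B}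
    (h : SymbolicConjugate 𝒜 ℬ) : AreConjugate 𝒜.labelShift ℬ.labelShift := by
  obtain ⟨_, ψ, _, hψ, _⟩ := h
  exact ⟨ψ, hψ⟩

end SoficShift

theorem mainTheorem3 {A A' : Type u} [Finite A] [Finite A']
    (X : Set (ℤ → A)) (X' : Set (ℤ → A'))
    (hX : SoficShift.IsSofic X) (hX' : SoficShift.IsSofic X') :
    List.TFAE
      [SoficShift.AreConjugate X X',
        SoficShift.SymbolicStrongShiftEquivalent
          (SoficShift.krieger X).adjacencyMatrix (SoficShift.krieger X').adjacencyMatrix,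
        SoficShift.SymbolicConjugate (SoficShift.krieger X) (SoficShift.krieger X')] ∧
    (SoficShift.IsIrreducible X → SoficShift.IsIrreducible X' →
      List.TFAE
        [SoficShift.AreConjugate X X',
          SoficShift.SymbolicStrongShiftEquivalent
            (SoficShift.fischer X).adjacencyMatrix (SoficShift.fischer X').adjacencyMatrix,
          SoficShift.SymbolicConjugate (SoficShift.fischer X) (SoficShift.fischer X')]) := by
  have hf := hX.finite_krieger
  constructor
  · tfae_have 1 → 2 := fun h => ((hX.linked_of_areConjugate h).2 hf).1
    tfae_have 2 → 3 := fun h => h.symbolicConjugate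
      (SoficShift.Automaton.locallyFinite_of_subsingleton _
        (SoficShift.subsingleton_krieger_edges _))
      (SoficShift.Automaton.locallyFinite_of_subsingleton _
        (SoficShift.subsingleton_krieger_edges _))
    tfae_have 3 → 1 := fun h => by
      have := h.areConjugate
      rwa [hX.labelShift_krieger, hX'.labelShift_krieger] at this
    tfae_finish
  · intro hirr hirr'
    have : Finite (SoficShift.fischer X).State :=
      inferInstanceAs (Finite (SoficShift.fischerStates X))
    tfae_have 1 → 2 := fun h => ((hX.linked_of_areConjugate h).2 hf).2
    tfae_have 2 → 3 := fun h => h.symbolicConjugate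
      (SoficShift.Automaton.locallyFinite_of_subsingleton _
        (SoficShift.subsingleton_restrict_edges _ _ (SoficShift.subsingleton_krieger_edges _)))
      (SoficShift.Automaton.locallyFinite_of_subsingleton _
        (SoficShift.subsingleton_restrict_edges _ _ (SoficShift.subsingleton_krieger_edges _)))
    tfae_have 3 → 1 := fun h => by
      have := h.areConjugate
      rwa [hX.labelShift_fischer hirr, hX'.labelShift_fischer hirr'] at this
    tfae_finish
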